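/- **Setting.** Let $\mathcal X,\mathcal Y,\hat{\mathcal X}_1,\hat{\mathcal X}_2$ be finite alphabets, $P_0$ a probability distribution on $\mathcal X\times\mathcal Y$ and $P(\hat x_1,\hat x_2|x,y)$ a conditional distribution on $\hat{\mathcal X}_1\times\hat{\mathcal X}_2$ given $(x,y)\in\mathcal X\times\mathcal Y$. The pairs $(X_i,Y_i)$, $i=1,2,\dots$, are i.i.d. $\sim P_0$. A cascade code of blocklength $n$ at rates $(R_1,R_2)\in\mathbb R^2$, with side information $Y^n$ at the source encoder and at User 1 but not at User 2, has message sets $\mathcal M_i$ with $\lfloor 2^{nR_i}\rfloor$ elements and consists of encoders $f_1:\mathcal X^n\times\mathcal Y^n\to\mathcal M_1$, $f_2:\mathcal Y^n\times\mathcal M_1\to\mathcal M_2$ and decoders $g_1:\mathcal Y^n\times\mathcal M_1\to\hat{\mathcal X}_1^n$, $g_2:\mathcal M_2\to\hat{\mathcal X}_2^n$; with $T_1=f_1(X^n,Y^n)$ and $T_2=f_2(Y^n,T_1)$ it produces $\hat X_1^n=g_1(Y^n,T_1)$ and $\hat X_2^n=g_2(T_2)$. In a code with common randomness, the four functions may also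 depend on a random variable $\omega$ with finite alphabet, independent of $(X^n,Y^n)$, whose alphabet and law are chosen with the code. The rate pair $(R_1,R_2)$ *achieves* empirical coordination toward $P_0(x,y)P(\hat x_1,\hat x_2|x,y)$ if there is a sequence of such codes, $n=1,2,\dots$, for which the total variation distance between the joint type (empirical distribution) of $(X^n,Y^n,\hat X_1^n,\hat X_2^n)$ and $P_0(x,y)P(\hat x_1,\hat x_2|x,y)$ tends to $0$ in probability as $n\to\infty$. For fixed $P_0$, the coordination capacity region is the closure of the set of all tuples $(R_1,R_2,P(\cdot,\cdot|\cdot,\cdot))$ such that $(R_1,R_2)$ achieves empirical coordination toward $P_0P$ by codes with common randomness, and the rate-coordination region $R_{P_0}(P(\hat x_1,\hat x_2|x,y))$ is its slice at the given conditional distribution. **Theorem (Rate coordination in the cascade problem).** The rate-coordination region $R_{P_0}(P(\hat x_1,\hat x_2|x,y))$ is exactly the set of $(R_1,R_2)\in\mathbb R^2$ with $$R_2\ge I(X,Y;\hat X_2),\qquad R_1\ge I(X;\hat X_1,\hat X_2\,|\,Y),$$ where the mutual informations are in bits and evaluated under the joint distribution $P_0(x,y)P(\hat x_1,\hat x_2|x,y)$.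 The same set is also the closure of the set of rate pairs that achieve empirical coordination toward $P_0(x,y)P(\hat x_1,\hat x_2|x,y)$ itself by codes without common randomness. -/

import Mathlib

open Filter Topology

/-- Mutual information `I(A;B)`, in bits, of a pair of finite-alphabet random variables with
joint probability mass function `p`. -/
noncomputable def mutualInfo {A B : Type*} [Fintype A] [Fintype B] (p : A × B → ℝ) : ℝ :=
  ∑ a, ∑ b, p (a, b) * Real.logb 2 (p (a, b) / ((∑ b', p (a, b')) * ∑ a', p (a', b)))

/-- Conditional mutual information `I(A;B|C)`, in bits, of three finite-alphabet random variables
with joint probability mass function `p`. -/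
noncomputable def condMutualInfo {A B C : Type*} [Fintype A] [Fintype B] [Fintype C]
    (p : A × B × C → ℝ) : ℝ :=
  ∑ a, ∑ b, ∑ c, p (a, b, c) *
    Real.logb 2 (p (a, b, c) * (∑ a', ∑ b', p (a', b', c)) /
      ((∑ b', p (a, b', c)) * ∑ a', p (a', b, c)))

/-- Total variation distance between two (mass) functions on a finite set. -/
noncomputable def tvDist {S : Type*} [Fintype S] (p q : S → ℝ) : ℝ :=
  (1 / 2) * ∑ s, |p s - q s|

open Classical in
/-- The joint type (empirical distribution) of a length-`n` sequence. -/
noncomputable def empiricalDist {S : Type*} {n : ℕ} (s : Fin n → S) (a : S) : ℝ :=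
  ((Finset.univ.filter fun i => s i = a).card : ℝ) / n

/-- The target distribution `P₀(x,y) P(x̂₁,x̂₂|x,y)`; its argument is `(x, y, x̂₁, x̂₂)`. -/
def targetDist {X Y X₁ X₂ : Type*} [Fintype X] [Fintype Y] [Fintype X₁] [Fintype X₂]
    (P₀ : stdSimplex ℝ (X × Y)) (Q : X × Y → stdSimplex ℝ (X₁ × X₂))
    (s : X × Y × X₁ × X₂) : ℝ :=
  P₀ (s.1, s.2.1) * Q (s.1, s.2.1) (s.2.2.1, s.2.2.2)

/-- A (deterministic) cascade code of blocklength `n` with side information at the source encoder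
and at the first user, with `M₁` messages on the first link and `M₂` on the second. -/
structure CascadeCode (X Y X₁ X₂ : Type*) (n M₁ M₂ : ℕ) where
  /-- the source encoder -/
  f₁ : (Fin n → X) → (Fin n → Y) → Fin M₁
  /-- the encoder at User 1 -/
  f₂ : (Fin n → Y) → Fin M₁ → Fin M₂
  /-- the decoder at User 1 -/
  g₁ : (Fin n → Y) → Fin M₁ → (Fin n → X₁)
  /-- the decoder at User 2 -/
  g₂ : Fin M₂ → (Fin n → X₂)

namespace CascadeCode

variable {X Y X₁ X₂ : Type*} {n M₁ M₂ : ℕ}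

/-- The sequence `(xᵢ, yᵢ, x̂₁ᵢ, x̂₂ᵢ)` produced by the code on source input `(xⁿ, yⁿ)`. -/
def output (C : CascadeCode X Y X₁ X₂ n M₁ M₂) (x : Fin n → X) (y : Fin n → Y) :
    Fin n → X × Y × X₁ × X₂ := fun i =>
  (x i, y i, C.g₁ y (C.f₁ x y) i, C.g₂ (C.f₂ y (C.f₁ x y)) i)

open Classical in
/-- The probability, for `(Xᵢ, Yᵢ)` i.i.d. with law `P₀`, that the joint type of the sequences
`(Xⁿ, Yⁿ, X̂₁ⁿ, X̂₂ⁿ)` is at total variation distance more than `ε` from `T`. -/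
noncomputable def errorProb [Fintype X] [Fintype Y] [Fintype X₁] [Fintype X₂]
    (C : CascadeCode X Y X₁ X₂ n M₁ M₂) (P₀ : stdSimplex ℝ (X × Y))
    (T : X × Y × X₁ × X₂ → ℝ) (ε : ℝ) : ℝ :=
  ∑ x : Fin n → X, ∑ y : Fin n → Y,
    if ε < tvDist (empiricalDist (C.output x y)) T then ∏ i, P₀ (x i, y i) else 0

end CascadeCode

/-- The number `⌊2^{nR}⌋` of messages at rate `R` and blocklength `n`. -/
noncomputable def numMessages (n : ℕ) (R : ℝ) : ℕ := ⌊(2 : ℝ) ^ ((n : ℝ) * R)⌋₊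

/-- The rate pair `R = (R₁, R₂)` achieves empirical coordination toward the target
`P₀(x,y) Q(x̂₁,x̂₂|x,y)` by deterministic codes: for some sequence of codes, the total variation
distance between the joint type and the target tends to zero in probability. -/
def Achievable {X Y X₁ X₂ : Type*} [Fintype X] [Fintype Y] [Fintype X₁] [Fintype X₂]
    (P₀ : stdSimplex ℝ (X × Y)) (Q : X × Y → stdSimplex ℝ (X₁ × X₂)) (R : ℝ × ℝ) : Prop :=
  ∃ C : ∀ n : ℕ, CascadeCode X Y X₁ X₂ n (numMessages n R.1) (numMessages n R.2),
    ∀ ε > 0, Tendsto (fun n => (C n).errorProb P₀ (targetDist P₀ Q) ε) atTop (𝓝 0)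

/-- Achievability of empirical coordination when all three nodes moreover share common randomness
`ω` with a finite alphabet (here `Fin (K n)`), a law `p n` chosen with the code, and independent of
the source: the four functions of the code may depend on `ω`. As there are finitely many
deterministic codes for each `n`, finite alphabets are no restriction. -/
def AchievableCR {X Y X₁ X₂ : Type*} [Fintype X] [Fintype Y] [Fintype X₁] [Fintype X₂]
    (P₀ : stdSimplex ℝ (X × Y)) (Q : X × Y → stdSimplex ℝ (X₁ × X₂)) (R : ℝ × ℝ) : Prop :=
  ∃ (K : ℕ → ℕ) (p : ∀ n, stdSimplex ℝ (Fin (K n)))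
    (C : ∀ n : ℕ, Fin (K n) → CascadeCode X Y X₁ X₂ n (numMessages n R.1) (numMessages n R.2)),
    ∀ ε > 0, Tendsto
      (fun n => ∑ ω, p n ω * (C n ω).errorProb P₀ (targetDist P₀ Q) ε) atTop (𝓝 0)

/-- The closure of the set of rate pairs that achieve the fixed target by deterministic codes. -/
def achievableRegion {X Y X₁ X₂ : Type*} [Fintype X] [Fintype Y] [Fintype X₁] [Fintype X₂]
    (P₀ : stdSimplex ℝ (X × Y)) (Q : X × Y → stdSimplex ℝ (X₁ × X₂)) : Set (ℝ × ℝ) :=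
  closure {R | Achievable P₀ Q R}

/-- The coordination capacity region: the closure of the set of all tuples of rates and
conditional distributions that are achievable. -/
def coordinationCapacityRegion {X Y : Type*} (X₁ X₂ : Type*)
    [Fintype X] [Fintype Y] [Fintype X₁] [Fintype X₂] (P₀ : stdSimplex ℝ (X × Y)) :
    Set ((ℝ × ℝ) × (X × Y → stdSimplex ℝ (X₁ × X₂))) :=
  closure {t | AchievableCR P₀ t.2 t.1}

/-- The rate-coordination region: the slice of the coordination capacity region at a fixed
conditional distribution. -/
def rateCoordinationRegion {X Y X₁ X₂ : Type*} [Fintype X] [Fintype Y] [Fintype X₁] [Fintype X₂]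
    (P₀ : stdSimplex ℝ (X × Y)) (Q : X × Y → stdSimplex ℝ (X₁ × X₂)) : Set (ℝ × ℝ) :=
  {R | (R, Q) ∈ coordinationCapacityRegion X₁ X₂ P₀}

/-- The rate pairs with `R₂ ≥ I(X,Y;X̂₂)` and `R₁ ≥ I(X;X̂₁,X̂₂|Y)`, where the joint law of
`(X, Y, X̂₁, X̂₂)` is the target distribution. -/
def informationRegion {X Y X₁ X₂ : Type*} [Fintype X] [Fintype Y] [Fintype X₁] [Fintype X₂]
    (P₀ : stdSimplex ℝ (X × Y)) (Q : X × Y → stdSimplex ℝ (X₁ × X₂)) : Set (ℝ × ℝ) :=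
  {R | mutualInfo (fun s : (X × Y) × X₂ => ∑ u : X₁, targetDist P₀ Q (s.1.1, s.1.2, u, s.2)) ≤ R.2 ∧
    condMutualInfo (fun s : X × (X₁ × X₂) × Y =>
      targetDist P₀ Q (s.1, s.2.2, s.2.1.1, s.2.1.2)) ≤ R.1}

/-!
Everything is expressed through the likelihood ratios `p(a,b|c) / (p(a|c) p(b|c))` whose mean
logarithms are the two mutual informations; on a jointly typical block of length `n` a product of
such ratios is `2 ^ (n (I ± δ))`.

*Direct part.* Draw for User 2 a random codebook of about `2 ^ (n R₂)` sequences, and for each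
side-information sequence a random list of about `2 ^ (n R₁)` pairs of a codeword index and a
sequence for User 1. A fresh list entry is jointly typical with the source block with probability
at least the inverse of the product ratio, so exponentially long lists fail only with vanishing
probability, and averaging fixes the codebook and the lists.

*Converse.* Average the product of the regularised ratios `r + η` over the source, with the
reconstruction held to the one given by a fixed message: for each letter the average is at most
`1 + η`, hence at most `(1 + η) ^ n` in total. On the typical blocks, which have probability at
least `1 / 2`, the product is at least `2 ^ (n (I - δ))` for the message actually sent, so there are
at least `2 ^ (n (I - δ)) / (2 (1 + η) ^ n)` messages. The regularisation keeps the logarithms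
bounded where the target vanishes. One good deterministic code per blocklength suffices, so common
randomness does not help and the bound survives the closure over targets.
-/

section InfoRatio

variable {A B C : Type*}

/-- The marginal of the first and third components, with which the joint law of a source letter
and the side information is read off from the law of a triple. -/
def margAC [Fintype B] (p : A × B × C → ℝ) (a : A) (c : C) : ℝ := ∑ b, p (a, b, c)

/-- The marginal of the second and third components. -/
def margBC [Fintype A] (p : A × B × C → ℝ) (b : B) (c : C) : ℝ := ∑ a, p (a, b, c)

/-- The marginal of the third component. -/
def margC [Fintype A] [Fintype B] (p : A × B × C → ℝ) (c : C) : ℝ := ∑ a, ∑ b, p (a, b, c)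

/-- The ratio `p(a,b|c) / (p(a|c) p(b|c))`, whose logarithm is the conditional information density.
Where a marginal vanishes it is `0` by the convention on division; `p` is zero there too. -/
noncomputable def infoRatio [Fintype A] [Fintype B] (p : A × B × C → ℝ) (s : A × B × C) : ℝ :=
  p s * margC p s.2.2 / (margAC p s.1 s.2.2 * margBC p s.2.1 s.2.2)

variable [Fintype A] [Fintype B] {p : A × B × C → ℝ}

theorem sum_margBC (p : A × B × C → ℝ) (c : C) : ∑ b, margBC p b c = margC p c :=
  Finset.sum_comm

omit [Fintype A] in
theorem margAC_nonneg (h0 : ∀ s, 0 ≤ p s) (a : A) (c : C) : 0 ≤ margAC p a c :=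
  Finset.sum_nonneg fun _ _ => h0 _

omit [Fintype B] in
theorem margBC_nonneg (h0 : ∀ s, 0 ≤ p s) (b : B) (c : C) : 0 ≤ margBC p b c :=
  Finset.sum_nonneg fun _ _ => h0 _

theorem margC_nonneg (h0 : ∀ s, 0 ≤ p s) (c : C) : 0 ≤ margC p c :=
  Finset.sum_nonneg fun _ _ => margAC_nonneg h0 _ _

theorem infoRatio_nonneg (h0 : ∀ s, 0 ≤ p s) (s : A × B × C) : 0 ≤ infoRatio p s :=
  div_nonneg (mul_nonneg (h0 s) (margC_nonneg h0 _))
    (mul_nonneg (margAC_nonneg h0 _ _) (margBC_nonneg h0 _ _))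

omit [Fintype A] in
theorem margAC_pos (h0 : ∀ s, 0 ≤ p s) {s : A × B × C} (h : 0 < p s) : 0 < margAC p s.1 s.2.2 :=
  Finset.sum_pos' (fun _ _ => h0 _) ⟨s.2.1, Finset.mem_univ _, h⟩

omit [Fintype B] in
theorem margBC_pos (h0 : ∀ s, 0 ≤ p s) {s : A × B × C} (h : 0 < p s) : 0 < margBC p s.2.1 s.2.2 :=
  Finset.sum_pos' (fun _ _ => h0 _) ⟨s.1, Finset.mem_univ _, h⟩

theorem margC_pos (h0 : ∀ s, 0 ≤ p s) {s : A × B × C} (h : 0 < p s) : 0 < margC p s.2.2 :=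
  Finset.sum_pos' (fun _ _ => margAC_nonneg h0 _ _) ⟨s.1, Finset.mem_univ _, margAC_pos h0 h⟩

theorem infoRatio_pos (h0 : ∀ s, 0 ≤ p s) {s : A × B × C} (h : 0 < p s) : 0 < infoRatio p s :=
  div_pos (mul_pos h (margC_pos h0 h)) (mul_pos (margAC_pos h0 h) (margBC_pos h0 h))

theorem sum_margAC_mul_infoRatio_le (h0 : ∀ s, 0 ≤ p s) (b : B) (c : C) :
    ∑ a, margAC p a c * infoRatio p (a, b, c) ≤ margC p c := by
  have hC := margC_nonneg h0 c
  calc ∑ a, margAC p a c * infoRatio p (a, b, c)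
      = ∑ a, margAC p a c / margAC p a c * (p (a, b, c) * (margC p c / margBC p b c)) :=
        Finset.sum_congr rfl fun a _ => by simp only [infoRatio]; ring
    _ ≤ ∑ a, p (a, b, c) * (margC p c / margBC p b c) :=
        Finset.sum_le_sum fun a _ => mul_le_of_le_one_left
          (mul_nonneg (h0 _) (div_nonneg hC (margBC_nonneg h0 b c))) (div_self_le_one _)
    _ = margC p c * (margBC p b c / margBC p b c) := by
        rw [← Finset.sum_mul, margBC]; ring
    _ ≤ margC p c := mul_le_of_le_one_right hC (div_self_le_one _)

theorem sum_margAC_mul_infoRatio_add_le (h0 : ∀ s, 0 ≤ p s) (η : ℝ) (b : B) (c : C) :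
    ∑ a, margAC p a c * (infoRatio p (a, b, c) + η) ≤ (1 + η) * margC p c := by
  have h := sum_margAC_mul_infoRatio_le h0 b c
  have hC : ∑ a, margAC p a c = margC p c := rfl
  simp only [mul_add, Finset.sum_add_distrib, ← Finset.sum_mul, hC]
  linarith

variable [Fintype C]

theorem sum_margC (p : A × B × C → ℝ) : ∑ c, margC p c = ∑ s, p s := by
  simp only [margC, Fintype.sum_prod_type]
  rw [Finset.sum_comm]
  exact Finset.sum_congr rfl fun a _ => Finset.sum_comm

theorem condMutualInfo_eq_sum (p : A × B × C → ℝ) :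
    condMutualInfo p = ∑ s, p s * Real.logb 2 (infoRatio p s) := by
  simp only [condMutualInfo, Fintype.sum_prod_type]
  rfl

theorem condMutualInfo_unit {p : A × B → ℝ} (h1 : ∑ s, p s = 1) :
    condMutualInfo (fun s : A × B × Unit => p (s.1, s.2.1)) = mutualInfo p := by
  rw [Fintype.sum_prod_type] at h1
  simp [condMutualInfo, mutualInfo, h1]

theorem sum_div_infoRatio_le (h0 : ∀ s, 0 ≤ p s) : ∑ s, p s / infoRatio p s ≤ ∑ s, p s := by
  have hle (s : A × B × C) : p s / infoRatio p s ≤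
      margAC p s.1 s.2.2 * margBC p s.2.1 s.2.2 / margC p s.2.2 := by
    rcases (h0 s).eq_or_lt with h | h
    · rw [← h, zero_div]
      exact div_nonneg (mul_nonneg (margAC_nonneg h0 _ _) (margBC_nonneg h0 _ _))
        (margC_nonneg h0 _)
    · rw [infoRatio, div_div_eq_mul_div, mul_div_mul_left _ _ h.ne']
  calc ∑ s, p s / infoRatio p s
      ≤ ∑ s : A × B × C, margAC p s.1 s.2.2 * margBC p s.2.1 s.2.2 / margC p s.2.2 :=
        Finset.sum_le_sum fun s _ => hle s
    _ = ∑ c, margC (fun s => margAC p s.1 s.2.2 * margBC p s.2.1 s.2.2 / margC p s.2.2) c :=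
        (sum_margC _).symm
    _ = ∑ c, margC p c * margC p c / margC p c := by
        refine Finset.sum_congr rfl fun c _ => ?_
        rw [margC]
        simp only [← Finset.sum_div, ← Finset.mul_sum, sum_margBC, ← Finset.sum_mul]
        rfl
    _ = ∑ s, p s := by simp only [mul_self_div_self, sum_margC]

-- Gibbs' inequality, from `1 - 1/r ≤ log r`.
theorem condMutualInfo_nonneg (h0 : ∀ s, 0 ≤ p s) : 0 ≤ condMutualInfo p := by
  have hle (s : A × B × C) : p s - p s / infoRatio p s ≤ p s * Real.log (infoRatio p s) := by
    rcases (h0 s).eq_or_lt with h | h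
    · simp [← h]
    · calc p s - p s / infoRatio p s = p s * (1 - (infoRatio p s)⁻¹) := by ring
        _ ≤ _ := mul_le_mul_of_nonneg_left
          (Real.one_sub_inv_le_log_of_pos (infoRatio_pos h0 h)) h.le
  rw [condMutualInfo_eq_sum]
  simp only [Real.logb, mul_div_assoc', ← Finset.sum_div]
  refine div_nonneg ?_ (Real.log_pos one_lt_two).le
  calc 0 ≤ ∑ s, p s - ∑ s, p s / infoRatio p s := sub_nonneg.2 (sum_div_infoRatio_le h0)
    _ ≤ _ := by
      rw [← Finset.sum_sub_distrib]
      exact Finset.sum_le_sum fun s _ => hle s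

end InfoRatio

section Links

variable {X Y W V : Type*}

/-- The law `T` of `(x, y, w, v)` as the law of the triple (source, both reconstructions, side
information) that governs the first link. -/
def firstLink (T : X × Y × W × V → ℝ) (s : X × (W × V) × Y) : ℝ :=
  T (s.1, s.2.2, s.2.1.1, s.2.1.2)

/-- The triple (both sources, reconstruction of User 2, no side information) that governs the
second link. The one-point type makes the unconditional mutual information a conditional one. -/
def secondLink [Fintype W] (T : X × Y × W × V → ℝ) (s : (X × Y) × V × Unit) : ℝ :=
  ∑ w, T (s.1.1, s.1.2, w, s.2.1)

variable [Fintype X] [Fintype W] [Fintype V] {T : X × Y × W × V → ℝ}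

/-- The ratio whose mean logarithm is `I(X;W,V|Y)`. -/
noncomputable def firstRatio (T : X × Y × W × V → ℝ) (s : X × Y × W × V) : ℝ :=
  infoRatio (firstLink T) (s.1, (s.2.2.1, s.2.2.2), s.2.1)

/-- The ratio whose mean logarithm is `I(X,Y;V)`. -/
noncomputable def secondRatio [Fintype Y] (T : X × Y × W × V → ℝ) (s : X × Y × W × V) : ℝ :=
  infoRatio (secondLink T) ((s.1, s.2.1), s.2.2.2, ())

omit [Fintype X] [Fintype V] in
theorem secondLink_nonneg (h0 : ∀ s, 0 ≤ T s) (s : (X × Y) × V × Unit) : 0 ≤ secondLink T s :=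
  Finset.sum_nonneg fun _ _ => h0 _

omit [Fintype X] [Fintype V] in
theorem secondLink_pos (h0 : ∀ s, 0 ≤ T s) {s : X × Y × W × V} (h : 0 < T s) :
    0 < secondLink T ((s.1, s.2.1), s.2.2.2, ()) :=
  Finset.sum_pos' (fun _ _ => h0 _) ⟨s.2.2.1, Finset.mem_univ _, h⟩

theorem firstRatio_nonneg (h0 : ∀ s, 0 ≤ T s) (s : X × Y × W × V) : 0 ≤ firstRatio T s :=
  infoRatio_nonneg (fun _ => h0 _) _

theorem firstRatio_pos (h0 : ∀ s, 0 ≤ T s) {s : X × Y × W × V} (h : 0 < T s) :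
    0 < firstRatio T s :=
  infoRatio_pos (fun _ => h0 _) h

variable [Fintype Y]

theorem secondRatio_nonneg (h0 : ∀ s, 0 ≤ T s) (s : X × Y × W × V) : 0 ≤ secondRatio T s :=
  infoRatio_nonneg (secondLink_nonneg h0) _

theorem secondRatio_pos (h0 : ∀ s, 0 ≤ T s) {s : X × Y × W × V} (h : 0 < T s) :
    0 < secondRatio T s :=
  infoRatio_pos (secondLink_nonneg h0) (secondLink_pos h0 h)

theorem sum_mul_firstLink (T f : X × Y × W × V → ℝ) :
    ∑ s, firstLink T s * f (s.1, s.2.2, s.2.1.1, s.2.1.2) = ∑ s, T s * f s := by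
  simp only [Fintype.sum_prod_type, firstLink]
  refine Finset.sum_congr rfl fun x _ => ?_
  simp_rw [Finset.sum_comm (t := (Finset.univ : Finset Y))]

theorem sum_secondLink_mul (T : X × Y × W × V → ℝ) (f : (X × Y) × V × Unit → ℝ) :
    ∑ s, secondLink T s * f s = ∑ s, T s * f ((s.1, s.2.1), s.2.2.2, ()) := by
  simp only [Fintype.sum_prod_type, secondLink, Finset.univ_unique, Finset.sum_singleton,
    Finset.sum_mul]
  exact Finset.sum_congr rfl fun x _ => Finset.sum_congr rfl fun y _ => Finset.sum_comm

theorem sum_firstLink (T : X × Y × W × V → ℝ) : ∑ s, firstLink T s = ∑ s, T s := by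
  simpa using sum_mul_firstLink T 1

theorem sum_secondLink (T : X × Y × W × V → ℝ) : ∑ s, secondLink T s = ∑ s, T s := by
  simpa using sum_secondLink_mul T 1

theorem condMutualInfo_firstLink (T : X × Y × W × V → ℝ) :
    condMutualInfo (firstLink T) = ∑ s, T s * Real.logb 2 (firstRatio T s) := by
  rw [condMutualInfo_eq_sum, ← sum_mul_firstLink]
  rfl

theorem condMutualInfo_secondLink (T : X × Y × W × V → ℝ) :
    condMutualInfo (secondLink T) = ∑ s, T s * Real.logb 2 (secondRatio T s) := by
  rw [condMutualInfo_eq_sum, sum_secondLink_mul]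
  rfl

end Links

section WeakLaw

open MeasureTheory ProbabilityTheory

variable {S : Type*} [Fintype S] {n : ℕ}

theorem sum_prod_seq (f : Fin n → S → ℝ) :
    ∑ s : Fin n → S, ∏ i, f i (s i) = ∏ i, ∑ a, f i a := by
  classical
  rw [Finset.prod_univ_sum, Fintype.piFinset_univ]

theorem tvDist_triangle (p q r : S → ℝ) : tvDist p r ≤ tvDist p q + tvDist q r := by
  rw [tvDist, tvDist, tvDist, ← mul_add, ← Finset.sum_add_distrib]
  exact mul_le_mul_of_nonneg_left (Finset.sum_le_sum fun a _ => abs_sub_le _ _ _) (by norm_num)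

theorem tvDist_self (p : S → ℝ) : tvDist p p = 0 := by simp [tvDist]

open Classical in
theorem sum_prod_of_le_abs_sub_le {T : S → ℝ} (h0 : ∀ a, 0 ≤ T a) (h1 : ∑ a, T a = 1) {f : S → ℝ}
    (hf : ∀ a, f a ∈ Set.Icc 0 1) {c : ℝ} (hc : 0 < c) :
    ∑ s : Fin n → S with c ≤ |∑ i, f (s i) - n * ∑ a, T a * f a|, ∏ i, T (s i) ≤
      n / (4 * c ^ 2) := by
  let _ : MeasurableSpace S := ⊤
  have : DiscreteMeasurableSpace S := ⟨fun _ => trivial⟩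
  let p : PMF S := PMF.ofFintype (fun a => ENNReal.ofReal (T a)) (by
    rw [← ENNReal.ofReal_sum_of_nonneg fun a _ => h0 a, h1, ENNReal.ofReal_one])
  let μ : Measure (Fin n → S) := Measure.pi fun _ => p.toMeasure
  let F : (Fin n → S) → ℝ := ∑ i, fun s => f (s i)
  have hμ (s : Fin n → S) : μ.real {s} = ∏ i, T (s i) := by
    simp [μ, p, Measure.real, Measure.pi_singleton, h0]
  have hmean : μ[F] = n * ∑ a, T a * f a := by
    simp only [F, Finset.sum_apply]
    rw [integral_finsetSum _ fun i _ => .of_finite]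
    simp [μ, integral_comp_eval AEStronglyMeasurable.of_discrete, PMF.integral_eq_sum, p, h0]
  have hvar : Var[F; μ] ≤ n / 4 := by
    rw [variance_sum_pi fun _ => .of_discrete]
    calc _ ≤ ∑ i : Fin n, ((1 - 0 : ℝ) / 2) ^ 2 := Finset.sum_le_sum fun i _ =>
          variance_le_sq_of_bounded (ae_of_all _ hf) .of_discrete
      _ = n / 4 := by
        simp only [Finset.sum_const, Finset.card_univ, Fintype.card_fin, nsmul_eq_mul]
        ring
  have hcheb := ENNReal.toReal_mono ENNReal.ofReal_ne_top
    (meas_ge_le_variance_div_sq (μ := μ) (X := F) .of_discrete hc)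
  rw [ENNReal.toReal_ofReal (div_nonneg (variance_nonneg F μ) (sq_nonneg c)), hmean] at hcheb
  calc _ = μ.real {s | c ≤ |F s - n * ∑ a, T a * f a|} := by
        simp only [← hμ, sum_measureReal_singleton, F, Finset.sum_apply, Finset.coe_filter,
          Finset.mem_univ, true_and]
    _ ≤ Var[F; μ] / c ^ 2 := hcheb
    _ ≤ n / 4 / c ^ 2 := by gcongr
    _ = n / (4 * c ^ 2) := div_div _ _ _

theorem exists_lt_abs_sub_of_lt_tvDist [Nonempty S] {p q : S → ℝ} {ε : ℝ} (h : ε < tvDist p q) :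
    ∃ a, 2 * ε / Fintype.card S < |p a - q a| := by
  by_contra! hle
  have hsum := Finset.sum_le_card_nsmul Finset.univ _ _ fun a _ => hle a
  rw [nsmul_eq_mul, Finset.card_univ, mul_div_cancel₀ _ (by positivity)] at hsum
  rw [tvDist] at h
  linarith

open Classical in
theorem sum_filter_le_sum_sum_filter {A I : Type*} [Fintype A] [Fintype I] {w : A → ℝ}
    (hw : ∀ a, 0 ≤ w a) {P : A → Prop} {Q : I → A → Prop} (h : ∀ a, P a → ∃ i, Q i a) :
    ∑ a with P a, w a ≤ ∑ i, ∑ a with Q i a, w a := by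
  simp only [Finset.sum_filter]
  rw [Finset.sum_comm]
  refine Finset.sum_le_sum fun a _ => ?_
  have hnonneg (i : I) : 0 ≤ if Q i a then w a else 0 := by split_ifs <;> simp [hw a]
  split_ifs with ha
  · obtain ⟨i, hi⟩ := h a ha
    calc w a = if Q i a then w a else 0 := (if_pos hi).symm
      _ ≤ _ := Finset.single_le_sum (fun j _ => hnonneg j) (Finset.mem_univ i)
  · exact Finset.sum_nonneg fun i _ => hnonneg i

omit [Fintype S] in
theorem natCast_mul_empiricalDist [DecidableEq S] (s : Fin n → S) (a : S) :
    n * empiricalDist s a = ∑ i, if s i = a then 1 else 0 := by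
  rcases Nat.eq_zero_or_pos n with rfl | hn
  · simp
  · rw [empiricalDist, mul_div_cancel₀ _ (by positivity), Finset.sum_boole]
    congr

open Classical in
theorem sum_prod_of_lt_tvDist_le {T : S → ℝ} (h0 : ∀ a, 0 ≤ T a) (h1 : ∑ a, T a = 1)
    (hn : 0 < n) {ε : ℝ} (hε : 0 < ε) :
    ∑ s : Fin n → S with ε < tvDist (empiricalDist s) T, ∏ i, T (s i) ≤
      Fintype.card S ^ 3 / (16 * (n * ε ^ 2)) := by
  have : Nonempty S := by
    by_contra! hS
    simp at h1
  let c : ℝ := n * (2 * ε / Fintype.card S)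
  have hc : 0 < c := by positivity
  let f (a : S) : S → ℝ := fun b => if b = a then 1 else 0
  have hdev (s : Fin n → S) (hs : ε < tvDist (empiricalDist s) T) :
      ∃ a, c ≤ |∑ i, f a (s i) - n * ∑ b, T b * f a b| := by
    obtain ⟨a, ha⟩ := exists_lt_abs_sub_of_lt_tvDist hs
    have hfreq : ∑ i, f a (s i) - n * ∑ b, T b * f a b = n * (empiricalDist s a - T a) := by
      rw [mul_sub, natCast_mul_empiricalDist]
      simp [f]
    exact ⟨a, by
      rw [hfreq, abs_mul, Nat.abs_cast]
      exact mul_le_mul_of_nonneg_left ha.le n.cast_nonneg⟩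
  calc _ ≤ ∑ a, ∑ s : Fin n → S with c ≤ |∑ i, f a (s i) - n * ∑ b, T b * f a b|,
        ∏ i, T (s i) :=
        sum_filter_le_sum_sum_filter (fun s => Finset.prod_nonneg fun i _ => h0 _) hdev
    _ ≤ ∑ _a : S, n / (4 * c ^ 2) := Finset.sum_le_sum fun a _ =>
        sum_prod_of_le_abs_sub_le h0 h1 (fun b => by simp only [f]; split_ifs <;> simp) hc
    _ = Fintype.card S ^ 3 / (16 * (n * ε ^ 2)) := by
        simp only [Finset.sum_const, Finset.card_univ, nsmul_eq_mul, c]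
        field_simp
        ring

theorem abs_sum_sub_le_tvDist (s : Fin n → S) (T : S → ℝ) {f : S → ℝ} {C : ℝ}
    (hf : ∀ a, |f a| ≤ C) :
    |∑ i, f (s i) - n * ∑ a, T a * f a| ≤ n * (2 * C * tvDist (empiricalDist s) T) := by
  classical
  have hsum : ∑ i, f (s i) = n * ∑ a, empiricalDist s a * f a := by
    simp only [Finset.mul_sum, ← mul_assoc, natCast_mul_empiricalDist, Finset.sum_mul]
    rw [Finset.sum_comm]
    simp
  rw [hsum, ← mul_sub, ← Finset.sum_sub_distrib, abs_mul, Nat.abs_cast]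
  gcongr
  calc _ ≤ ∑ a, |empiricalDist s a * f a - T a * f a| := Finset.abs_sum_le_sum_abs _ _
    _ ≤ ∑ a, |empiricalDist s a - T a| * C := Finset.sum_le_sum fun a _ => by
        rw [← sub_mul, abs_mul]
        exact mul_le_mul_of_nonneg_left (hf a) (abs_nonneg _)
    _ = 2 * C * tvDist (empiricalDist s) T := by
        rw [tvDist, ← Finset.sum_mul]
        ring

theorem prod_mem_Icc_of_tvDist_le {T r : S → ℝ} {s : Fin n → S} (hr : ∀ i, 0 < r (s i)) {C δ : ℝ}
    (hC : ∀ a, |Real.logb 2 (r a)| ≤ C) (hs : 2 * C * tvDist (empiricalDist s) T ≤ δ) :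
    ∏ i, r (s i) ∈ Set.Icc ((2 : ℝ) ^ (n * (∑ a, T a * Real.logb 2 (r a) - δ)))
      ((2 : ℝ) ^ (n * (∑ a, T a * Real.logb 2 (r a) + δ))) := by
  have hprod : ∏ i, r (s i) = (2 : ℝ) ^ ∑ i, Real.logb 2 (r (s i)) := by
    rw [Real.rpow_sum_of_pos two_pos]
    exact Finset.prod_congr rfl fun i _ => (Real.rpow_logb two_pos (by norm_num) (hr i)).symm
  obtain ⟨hlower, hupper⟩ := abs_le.1 ((abs_sum_sub_le_tvDist s T hC).trans
    (mul_le_mul_of_nonneg_left hs n.cast_nonneg))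
  rw [hprod]
  constructor <;> refine Real.rpow_le_rpow_of_exponent_le one_le_two ?_ <;> linarith

end WeakLaw

section Covering

theorem exp_neg_mul_le_one_sub {k h : ℝ} (hk : 0 ≤ k) (h0 : 0 ≤ h) (h1 : h ≤ 1) :
    Real.exp (-(k * h)) ≤ 1 - k / (1 + k) * h := by
  have : 0 ≤ k * h := mul_nonneg hk h0
  calc Real.exp (-(k * h)) ≤ 1 / (1 + k * h) := by
        rw [Real.exp_neg, ← one_div]
        exact one_div_le_one_div_of_le (by positivity) (by linarith [Real.add_one_le_exp (k * h)])
    _ = 1 - k / (1 + k) * h - k ^ 2 * (h * (1 - h)) / ((1 + k) * (1 + k * h)) := by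
        field_simp
        ring
    _ ≤ 1 - k / (1 + k) * h := sub_le_self _ (by have := sub_nonneg.2 h1; positivity)

theorem exp_neg_mul_le_one_sub_add_inv {k h : ℝ} (hk : 0 < k) (h0 : 0 ≤ h) (h1 : h ≤ 1) :
    Real.exp (-(k * h)) ≤ 1 - h + 1 / k :=
  calc Real.exp (-(k * h)) ≤ 1 - k / (1 + k) * h := exp_neg_mul_le_one_sub hk.le h0 h1
    _ = 1 - h + h / (1 + k) := by field_simp; ring
    _ ≤ 1 - h + 1 / k := by gcongr; linarith

theorem exp_neg_mul_div_le {k g s t : ℝ} (hk : 0 ≤ k) (hg : 0 ≤ g) (hgs : g ≤ s) (ht : 0 < t) :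
    Real.exp (-(k * (g / s))) ≤ s / t + Real.exp (-(k * (g / t))) := by
  have hs : 0 ≤ s := hg.trans hgs
  rcases le_or_gt s t with hst | hst
  · refine le_add_of_nonneg_of_le (by positivity) (Real.exp_le_exp.2 (neg_le_neg ?_))
    rcases hs.eq_or_lt with rfl | hs
    · simp [le_antisymm hgs hg]
    · gcongr
  · exact le_add_of_le_of_nonneg ((Real.exp_le_one_iff.2 (neg_nonpos.2 (by positivity))).trans
      ((one_le_div ht).2 hst.le)) (Real.exp_pos _).le

theorem exists_le_of_sum_mul_le {ι : Type*} [Fintype ι] {w f : ι → ℝ} (hw : ∀ i, 0 ≤ w i)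
    (h1 : ∑ i, w i = 1) {b : ℝ} (h : ∑ i, w i * f i ≤ b) : ∃ i, f i ≤ b := by
  obtain ⟨i, -, hi⟩ := (concaveOn_id convex_univ).exists_le_of_centerMass (t := Finset.univ)
    (w := w) (p := f) (fun i _ => hw i) (h1 ▸ one_pos) fun _ _ => Set.mem_univ _
  simp only [Finset.centerMass_eq_of_sum_1 _ _ h1, id_eq, smul_eq_mul] at hi
  exact ⟨i, hi.trans h⟩

variable {A X Y U V : Type*} [Fintype A] [Fintype X] [Fintype Y] [Fintype U] [Fintype V]

open Classical in
theorem exists_list_covering [Nonempty U] {p : A → ℝ} (hp : ∀ a, 0 ≤ p a) {g : U → ℝ}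
    (hg : ∀ u, 0 ≤ g u) (G : A → U → Prop) (M : ℕ) :
    ∃ φ : Fin M → U, ∑ a with ∀ m, ¬ G a (φ m), p a ≤
      ∑ a, p a * Real.exp (-(M * ((∑ u with G a u, g u) / ∑ u, g u))) := by
  rcases (Finset.sum_nonneg fun u (_ : u ∈ Finset.univ) => hg u).eq_or_lt with hS | hS
  · refine ⟨fun _ => Classical.arbitrary U, ?_⟩
    simpa [← hS] using Finset.sum_le_sum_of_subset_of_nonneg (Finset.filter_subset _ _)
      fun a _ _ => hp a
  have hmiss (a : A) : ∑ u, (if G a u then 0 else g u / ∑ u, g u) =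
      1 - (∑ u with G a u, g u) / ∑ u, g u := by
    rw [eq_sub_iff_add_eq, Finset.sum_filter, Finset.sum_div, ← Finset.sum_add_distrib,
      ← div_self hS.ne', Finset.sum_div]
    exact Finset.sum_congr rfl fun u _ => by split_ifs <;> simp
  refine exists_le_of_sum_mul_le (w := fun φ => ∏ m, g (φ m) / ∑ u, g u)
    (fun φ => Finset.prod_nonneg fun m _ => div_nonneg (hg _) hS.le) ?_ ?_
  · rw [sum_prod_seq fun _ u => g u / ∑ u, g u, ← Finset.sum_div, div_self hS.ne']
    exact Finset.prod_const_one
  have hprod (φ : Fin M → U) (a : A) : (∏ m, g (φ m) / ∑ u, g u) *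
      (if ∀ m, ¬ G a (φ m) then p a else 0) =
      p a * ∏ m, if G a (φ m) then 0 else g (φ m) / ∑ u, g u := by
    split_ifs with h
    · simp only [h, if_false, mul_comm]
    · push Not at h
      obtain ⟨m, hm⟩ := h
      rw [mul_zero, eq_comm]
      exact mul_eq_zero_of_right _ (Finset.prod_eq_zero (Finset.mem_univ m) (if_pos hm))
  simp only [Finset.sum_filter, Finset.mul_sum, hprod]
  rw [Finset.sum_comm]
  refine Finset.sum_le_sum fun a _ => ?_
  rw [← Finset.mul_sum, sum_prod_seq fun _ u => if G a u then 0 else g u / ∑ u, g u, hmiss,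
    Finset.prod_const, Finset.card_univ, Fintype.card_fin, ← mul_neg, Real.exp_nat_mul,
    ← Finset.sum_filter]
  refine mul_le_mul_of_nonneg_left (pow_le_pow_left₀ ?_ (Real.one_sub_le_exp_neg _) M) (hp a)
  rw [← hmiss]
  exact Finset.sum_nonneg fun u _ => by
    split_ifs
    exacts [le_rfl, div_nonneg (hg u) hS.le]

open Classical in
/-- The normaliser `∑ u, g y u` of the weights is traded for the constant multiple
`N * ∑ x, P (x, y)` of the law of `y`: where it is larger, `y` is given up, at a total cost of
`(∑ y, ∑ u, g y u) / N`. -/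
theorem exists_list_covering_sideInfo [Nonempty U] {P : X × Y → ℝ} (hP : ∀ a, 0 ≤ P a)
    {g : Y → U → ℝ} (hg : ∀ y u, 0 ≤ g y u) (G : X × Y → U → Prop) (M : ℕ) {N : ℝ} (hN : 0 < N) :
    ∃ φ : Y → Fin M → U, ∑ a with ∀ m, ¬ G a (φ a.2 m), P a ≤ (∑ y, ∑ u, g y u) / N +
      ∑ a, P a * Real.exp (-(M * ((∑ u with G a u, g a.2 u) / (N * ∑ x, P (x, a.2))))) := by
  choose φ hφ using fun y => exists_list_covering (fun x => hP (x, y)) (hg y)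
    (fun x => G (x, y)) M
  refine ⟨φ, ?_⟩
  have hS (y : Y) : 0 ≤ ∑ u, g y u := Finset.sum_nonneg fun u _ => hg y u
  have hpt (x : X) (y : Y) :
      P (x, y) * Real.exp (-(M * ((∑ u with G (x, y) u, g y u) / ∑ u, g y u))) ≤
        P (x, y) * ((∑ u, g y u) / (N * ∑ x, P (x, y))) +
          P (x, y) * Real.exp (-(M * ((∑ u with G (x, y) u, g y u) / (N * ∑ x, P (x, y))))) := by
    rcases (hP (x, y)).eq_or_lt with h0 | h0
    · simp [← h0]
    rw [← mul_add]
    have hpos : 0 < ∑ x, P (x, y) := Finset.sum_pos' (fun x _ => hP _) ⟨x, Finset.mem_univ x, h0⟩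
    exact mul_le_mul_of_nonneg_left (exp_neg_mul_div_le M.cast_nonneg
      (Finset.sum_nonneg fun u _ => hg y u) (Finset.sum_le_sum_of_subset_of_nonneg
        (Finset.filter_subset _ _) fun u _ _ => hg y u) (mul_pos hN hpos)) h0.le
  have hcost (y : Y) : ∑ x, P (x, y) * ((∑ u, g y u) / (N * ∑ x, P (x, y))) ≤
      (∑ u, g y u) / N :=
    calc _ = (∑ u, g y u) / N * ((∑ x, P (x, y)) / ∑ x, P (x, y)) := by
          rw [← Finset.sum_mul]
          ring
      _ ≤ _ := mul_le_of_le_one_right (div_nonneg (hS y) hN.le) (div_self_le_one _)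
  rw [Finset.sum_filter, Finset.sum_div, Fintype.sum_prod_type_right,
    Fintype.sum_prod_type_right, ← Finset.sum_add_distrib]
  refine Finset.sum_le_sum fun y _ => ?_
  calc _ = ∑ x with ∀ m, ¬ G (x, y) (φ y m), P (x, y) := (Finset.sum_filter _ _).symm
    _ ≤ _ := hφ y
    _ ≤ _ := Finset.sum_le_sum fun x _ => hpt x y
    _ ≤ _ := by
      rw [Finset.sum_add_distrib]
      exact add_le_add_left (hcost y) _

theorem mul_sum_mul_exp_pow_le {P m : ℝ} (hm : 0 ≤ m) (hmP : m ≤ P) {q : V → ℝ}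
    (hq : ∀ v, 0 ≤ q v) (hq1 : ∑ v, q v = 1) {h : V → ℝ} (h0 : ∀ v, 0 ≤ h v) (h1 : ∀ v, h v ≤ 1)
    {Λ κ : ℝ} (hΛ : 0 < Λ) (hκ : 0 < κ) (hmh : m ≤ Λ * P * ∑ v, q v * h v) {M : ℕ} (hM : 0 < M) :
    P * (∑ v, q v * Real.exp (-(κ * h v))) ^ M ≤ P - m + Λ * (1 + κ) / (κ * M) * P := by
  rcases (hm.trans hmP).eq_or_lt with hP | hP
  · simp [← hP, le_antisymm (hP ▸ hmP) hm]
  have : (0 : ℝ) < M := Nat.cast_pos.2 hM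
  let lam : ℝ := κ * M / (Λ * (1 + κ))
  have hlam : 0 < lam := by positivity
  have hmean : ∑ v, q v * Real.exp (-(κ * h v)) ≤ Real.exp (-(κ / (1 + κ) * ∑ v, q v * h v)) :=
    calc _ ≤ ∑ v, q v * (1 - κ / (1 + κ) * h v) := Finset.sum_le_sum fun v _ =>
          mul_le_mul_of_nonneg_left (exp_neg_mul_le_one_sub hκ.le (h0 v) (h1 v)) (hq v)
      _ = 1 - κ / (1 + κ) * ∑ v, q v * h v := by
          simp only [mul_sub, mul_one, Finset.sum_sub_distrib, hq1, Finset.mul_sum, mul_left_comm]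
      _ ≤ _ := Real.one_sub_le_exp_neg _
  calc P * (∑ v, q v * Real.exp (-(κ * h v))) ^ M
      ≤ P * Real.exp (-(κ / (1 + κ) * ∑ v, q v * h v)) ^ M := by
        gcongr
        exact Finset.sum_nonneg fun v _ => mul_nonneg (hq v) (Real.exp_pos _).le
    _ ≤ P * Real.exp (-(lam * (m / P))) := by
        rw [← Real.exp_nat_mul]
        gcongr
        rw [mul_neg, neg_le_neg_iff]
        calc lam * (m / P) ≤ lam * (Λ * ∑ v, q v * h v) := by
              gcongr
              exact (div_le_iff₀ hP).2 (hmh.trans_eq (mul_right_comm _ _ _))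
          _ = M * (κ / (1 + κ) * ∑ v, q v * h v) := by
              simp only [lam]
              field_simp
    _ ≤ P * (1 - m / P + 1 / lam) := mul_le_mul_of_nonneg_left
        (exp_neg_mul_le_one_sub_add_inv hlam (div_nonneg hm hP.le) ((div_le_one hP).2 hmP)) hP.le
    _ = P - m + Λ * (1 + κ) / (κ * M) * P := by
        simp only [lam]
        field_simp

theorem exists_codebook_sum_exp_le {P m : A → ℝ} (hm : ∀ a, 0 ≤ m a) (hmP : ∀ a, m a ≤ P a)
    {q : V → ℝ} (hq : ∀ v, 0 ≤ q v) (hq1 : ∑ v, q v = 1) {h : A → V → ℝ}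
    (h0 : ∀ a v, 0 ≤ h a v) (h1 : ∀ a v, h a v ≤ 1) {Λ κ : ℝ} (hΛ : 0 < Λ) (hκ : 0 < κ)
    (hmh : ∀ a, m a ≤ Λ * P a * ∑ v, q v * h a v) {M : ℕ} (hM : 0 < M) :
    ∃ c : Fin M → V, ∑ a, P a * Real.exp (-(κ * ∑ j, h a (c j))) ≤
      ∑ a, (P a - m a) + Λ * (1 + κ) / (κ * M) * ∑ a, P a := by
  refine exists_le_of_sum_mul_le (w := fun c => ∏ j, q (c j))
    (fun c => Finset.prod_nonneg fun j _ => hq _) ?_ ?_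
  · rw [sum_prod_seq fun _ => q, hq1]
    exact Finset.prod_const_one
  calc ∑ c : Fin M → V, (∏ j, q (c j)) * ∑ a, P a * Real.exp (-(κ * ∑ j, h a (c j)))
      = ∑ a, P a * ∑ c : Fin M → V, ∏ j, q (c j) * Real.exp (-(κ * h a (c j))) := by
        simp only [Finset.mul_sum, ← Finset.sum_neg_distrib, Real.exp_sum,
          Finset.prod_mul_distrib, mul_left_comm]
        exact Finset.sum_comm
    _ = ∑ a, P a * (∑ v, q v * Real.exp (-(κ * h a v))) ^ M := by
        refine Finset.sum_congr rfl fun a _ => ?_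
        rw [sum_prod_seq fun _ v => q v * Real.exp (-(κ * h a v)), Finset.prod_const,
          Finset.card_univ, Fintype.card_fin]
    _ ≤ ∑ a, (P a - m a + Λ * (1 + κ) / (κ * M) * P a) := Finset.sum_le_sum fun a _ =>
        mul_sum_mul_exp_pow_le (hm a) (hmP a) hq hq1 (h0 a) (h1 a) hΛ hκ (hmh a) hM
    _ = _ := by rw [Finset.sum_add_distrib, Finset.mul_sum]

end Covering

section CascadeCovering

variable {X Y W V : Type*} [Fintype X] [Fintype Y] [Fintype W] [Fintype V]
  {T : X × Y × W × V → ℝ}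

omit [Fintype X] [Fintype Y] in
theorem margAC_firstLink (T : X × Y × W × V → ℝ) (x : X) (y : Y) :
    margAC (firstLink T) x y = margAC (secondLink T) (x, y) () :=
  Fintype.sum_prod_type_right _

omit [Fintype Y] in
theorem margC_firstLink (T : X × Y × W × V → ℝ) (y : Y) :
    margC (firstLink T) y = ∑ x, margAC (secondLink T) (x, y) () :=
  Finset.sum_congr rfl fun x _ => margAC_firstLink T x y

omit [Fintype V] in
theorem sum_margBC_firstLink (T : X × Y × W × V → ℝ) (v : V) :
    ∑ y, ∑ w, margBC (firstLink T) (w, v) y = margBC (secondLink T) v () := by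
  simp only [margBC, firstLink, secondLink, Fintype.sum_prod_type_right]
  exact Finset.sum_congr rfl fun y _ => Finset.sum_comm

theorem margC_secondLink (T : X × Y × W × V → ℝ) : margC (secondLink T) () = ∑ s, T s := by
  rw [← sum_secondLink, ← sum_margC]
  simp

theorem firstRatio_mul_eq (h0 : ∀ s, 0 ≤ T s) (h1 : ∑ s, T s = 1) {s : X × Y × W × V}
    (h : 0 < T s) :
    firstRatio T s * (margBC (firstLink T) s.2.2 s.2.1 / margBC (secondLink T) s.2.2.2 ()) =
      secondRatio T s * (T s / secondLink T ((s.1, s.2.1), s.2.2.2, ())) *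
        margC (firstLink T) s.2.1 := by
  have hBC := (margBC_pos (p := firstLink T) (fun _ => h0 _)
    (s := (s.1, s.2.2, s.2.1)) h).ne'
  have hlink := (secondLink_pos h0 h).ne'
  have hC : margC (secondLink T) () = 1 := (margC_secondLink T).trans h1
  simp only [firstRatio, secondRatio, infoRatio, margAC_firstLink, hC, mul_one]
  rw [show firstLink T (s.1, (s.2.2.1, s.2.2.2), s.2.1) = T s from rfl]
  field_simp

open Classical in
/-- The conditional probability, given `(x, y, v)`, that the reconstruction of User 1 completes it
to an element of `F`. It is `0` where the conditioning event is null. -/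
noncomputable def completionProb (T : X × Y × W × V → ℝ) (F : X × Y × W × V → Prop) (b : X × Y)
    (v : V) : ℝ :=
  (∑ w with F (b.1, b.2, w, v), T (b.1, b.2, w, v)) / secondLink T (b, v, ())

omit [Fintype X] [Fintype Y] [Fintype V] in
theorem completionProb_nonneg (h0 : ∀ s, 0 ≤ T s) (F : X × Y × W × V → Prop) (b : X × Y) (v : V) :
    0 ≤ completionProb T F b v :=
  div_nonneg (Finset.sum_nonneg fun _ _ => h0 _) (secondLink_nonneg h0 _)

omit [Fintype X] [Fintype Y] [Fintype V] in
open Classical in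
theorem completionProb_le_one (h0 : ∀ s, 0 ≤ T s) (F : X × Y × W × V → Prop) (b : X × Y) (v : V) :
    completionProb T F b v ≤ 1 :=
  div_le_one_of_le₀ (Finset.sum_le_sum_of_subset_of_nonneg (Finset.filter_subset _ _)
    fun _ _ _ => h0 _) (secondLink_nonneg h0 _)

variable {F : X × Y × W × V → Prop}

open Classical in
theorem completionProb_mul_le (h0 : ∀ s, 0 ≤ T s) (h1 : ∑ s, T s = 1) (hF : ∀ s, F s → 0 < T s)
    {a D : ℝ} (hFa : ∀ s, F s → a ≤ secondRatio T s) (hFD : ∀ s, F s → firstRatio T s ≤ D)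
    (b : X × Y) (v : V) :
    a * completionProb T F b v * margC (firstLink T) b.2 ≤
      D * ∑ w with F (b.1, b.2, w, v),
        margBC (firstLink T) (w, v) b.2 / margBC (secondLink T) v () := by
  simp only [completionProb, Finset.sum_div, Finset.mul_sum, Finset.sum_mul]
  refine Finset.sum_le_sum fun w hw => ?_
  have hFw := (Finset.mem_filter.1 hw).2
  have hC := margC_nonneg (p := firstLink T) (fun _ => h0 _) b.2
  have hBC := margBC_nonneg (p := firstLink T) (fun _ => h0 _) (w, v) b.2
  have hBC' := margBC_nonneg (secondLink_nonneg h0) v ()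
  have hlink := secondLink_nonneg h0 (b, v, ())
  calc a * (T (b.1, b.2, w, v) / secondLink T (b, v, ())) * margC (firstLink T) b.2
      ≤ secondRatio T (b.1, b.2, w, v) * (T (b.1, b.2, w, v) / secondLink T (b, v, ())) *
          margC (firstLink T) b.2 := by
        gcongr
        · exact div_nonneg (h0 _) hlink
        · exact hFa _ hFw
    _ = firstRatio T (b.1, b.2, w, v) *
          (margBC (firstLink T) (w, v) b.2 / margBC (secondLink T) v ()) :=
        (firstRatio_mul_eq h0 h1 (hF _ hFw)).symm
    _ ≤ D * (margBC (firstLink T) (w, v) b.2 / margBC (secondLink T) v ()) := by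
        gcongr
        exact hFD _ hFw

open Classical in
theorem sum_filter_le_completionProb (h0 : ∀ s, 0 ≤ T s) (h1 : ∑ s, T s = 1)
    (hF : ∀ s, F s → 0 < T s) {A : ℝ} (hFA : ∀ s, F s → secondRatio T s ≤ A) (b : X × Y) :
    ∑ v, ∑ w with F (b.1, b.2, w, v), T (b.1, b.2, w, v) ≤
      A * margAC (secondLink T) b () *
        ∑ v, margBC (secondLink T) v () * completionProb T F b v := by
  rw [Finset.mul_sum]
  refine Finset.sum_le_sum fun v _ => ?_
  rw [completionProb, Finset.sum_div, Finset.mul_sum, Finset.mul_sum]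
  refine Finset.sum_le_sum fun w hw => ?_
  have hFw := (Finset.mem_filter.1 hw).2
  have hpos : 0 < secondLink T (b, v, ()) := secondLink_pos h0 (hF _ hFw)
  have hAC : 0 < margAC (secondLink T) b () :=
    margAC_pos (secondLink_nonneg h0) (s := (b, v, ())) hpos
  have hBC : 0 < margBC (secondLink T) v () :=
    margBC_pos (secondLink_nonneg h0) (s := (b, v, ())) hpos
  have hA : secondLink T (b, v, ()) ≤
      A * (margAC (secondLink T) b () * margBC (secondLink T) v ()) := by
    have h := hFA _ hFw
    rwa [secondRatio, infoRatio, margC_secondLink, h1, mul_one, div_le_iff₀ (mul_pos hAC hBC)] at h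
  calc T (b.1, b.2, w, v)
      = secondLink T (b, v, ()) * (T (b.1, b.2, w, v) / secondLink T (b, v, ())) :=
        (mul_div_cancel₀ _ hpos.ne').symm
    _ ≤ A * (margAC (secondLink T) b () * margBC (secondLink T) v ()) *
          (T (b.1, b.2, w, v) / secondLink T (b, v, ())) :=
        mul_le_mul_of_nonneg_right hA (div_nonneg (h0 _) hpos.le)
    _ = _ := by ring

/-- The weights with which, given the side information `y`, the entries of the list of User 1 are
drawn for a codebook `c` of User 2: an entry `(j, w)` has the conditional probability of `(y, w)`
given the codeword `c j`. -/
noncomputable def listWeight {M : ℕ} (T : X × Y × W × V → ℝ) (c : Fin M → V) (y : Y)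
    (u : Fin M × W) : ℝ :=
  margBC (firstLink T) (u.2, c u.1) y / margBC (secondLink T) (c u.1) ()

omit [Fintype V] in
theorem listWeight_nonneg {M : ℕ} (h0 : ∀ s, 0 ≤ T s) (c : Fin M → V) (y : Y) (u : Fin M × W) :
    0 ≤ listWeight T c y u :=
  div_nonneg (margBC_nonneg (fun _ => h0 _) _ _) (margBC_nonneg (secondLink_nonneg h0) _ _)

omit [Fintype V] in
theorem sum_listWeight_le {M : ℕ} (T : X × Y × W × V → ℝ) (c : Fin M → V) :
    ∑ y, ∑ u, listWeight T c y u ≤ M :=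
  calc ∑ y, ∑ u, listWeight T c y u = ∑ j, ∑ y, ∑ w, listWeight T c y (j, w) := by
        simp only [Fintype.sum_prod_type]
        exact Finset.sum_comm
    _ = ∑ j, margBC (secondLink T) (c j) () / margBC (secondLink T) (c j) () := by
        simp only [listWeight, ← Finset.sum_div, sum_margBC_firstLink]
    _ ≤ ∑ _j : Fin M, 1 := Finset.sum_le_sum fun j _ => div_self_le_one _
    _ = M := by simp

open Classical in
theorem sum_completionProb_mul_le (h0 : ∀ s, 0 ≤ T s) (h1 : ∑ s, T s = 1)
    (hF : ∀ s, F s → 0 < T s) {a D : ℝ} (hFa : ∀ s, F s → a ≤ secondRatio T s)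
    (hFD : ∀ s, F s → firstRatio T s ≤ D) {M : ℕ} (c : Fin M → V) (b : X × Y) :
    a * (∑ j, completionProb T F b (c j)) * margC (firstLink T) b.2 ≤
      D * ∑ u with F (b.1, b.2, u.2, c u.1), listWeight T c b.2 u :=
  calc _ = ∑ j, a * completionProb T F b (c j) * margC (firstLink T) b.2 := by
        rw [Finset.mul_sum, Finset.sum_mul]
    _ ≤ ∑ j, D * ∑ w with F (b.1, b.2, w, c j), listWeight T c b.2 (j, w) :=
        Finset.sum_le_sum fun j _ => completionProb_mul_le h0 h1 hF hFa hFD b (c j)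
    _ = _ := by simp only [← Finset.mul_sum, Finset.sum_filter, Fintype.sum_prod_type]

open Classical in
theorem exists_lists_of_codebook (h0 : ∀ s, 0 ≤ T s) (h1 : ∑ s, T s = 1)
    (hF : ∀ s, F s → 0 < T s) {a D z : ℝ} (hD : 0 < D) (hz : 0 < z)
    (hFa : ∀ s, F s → a ≤ secondRatio T s) (hFD : ∀ s, F s → firstRatio T s ≤ D)
    (M₁ : ℕ) {M₂ : ℕ} (hM₂ : 0 < M₂) (c : Fin M₂ → V) :
    ∃ φ : Y → Fin M₁ → Fin M₂ × W,
      ∑ b : X × Y with ∀ m, ¬ F (b.1, b.2, (φ b.2 m).2, c (φ b.2 m).1),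
          margAC (secondLink T) b () ≤
        1 / z + ∑ b, margAC (secondLink T) b () *
          Real.exp (-(M₁ * a / (z * M₂ * D) * ∑ j, completionProb T F b (c j))) := by
  have : Nonempty (Fin M₂) := ⟨⟨0, hM₂⟩⟩
  have : Nonempty W := by
    by_contra! hW
    simp at h1
  have hM₂' : (0 : ℝ) < M₂ := Nat.cast_pos.2 hM₂
  have hAC (b : X × Y) : 0 ≤ margAC (secondLink T) b () := margAC_nonneg (secondLink_nonneg h0) _ _
  obtain ⟨φ, hφ⟩ := exists_list_covering_sideInfo hAC (listWeight_nonneg h0 c)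
    (fun b u => F (b.1, b.2, u.2, c u.1)) M₁ (mul_pos hz hM₂')
  refine ⟨φ, hφ.trans (add_le_add ?_ (Finset.sum_le_sum fun b _ => ?_))⟩
  · calc (∑ y, ∑ u, listWeight T c y u) / (z * M₂) ≤ M₂ / (z * M₂) := by
          gcongr
          exact sum_listWeight_le T c
      _ = 1 / z := by field_simp
  rcases (hAC b).eq_or_lt with hb | hb
  · simp [← hb]
  have hC : 0 < margC (firstLink T) b.2 := by
    rw [margC_firstLink]
    exact Finset.sum_pos' (fun x _ => hAC _) ⟨b.1, Finset.mem_univ _, hb⟩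
  rw [← margC_firstLink]
  refine mul_le_mul_of_nonneg_left (Real.exp_le_exp.2 (neg_le_neg ?_)) hb.le
  calc M₁ * a / (z * M₂ * D) * ∑ j, completionProb T F b (c j)
      = M₁ / (z * M₂ * D * margC (firstLink T) b.2) *
          (a * (∑ j, completionProb T F b (c j)) * margC (firstLink T) b.2) := by field_simp
    _ ≤ M₁ / (z * M₂ * D * margC (firstLink T) b.2) *
          (D * ∑ u with F (b.1, b.2, u.2, c u.1), listWeight T c b.2 u) := by
        exact mul_le_mul_of_nonneg_left (sum_completionProb_mul_le h0 h1 hF hFa hFD c b)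
          (by positivity)
    _ = _ := by field_simp

open Classical in
/-- User 2 has a codebook `c`; User 1 receives an index into a list, one for each value of
the side information, of pairs of an index into `c` and a reconstruction. -/
theorem exists_cascade_covering (h0 : ∀ s, 0 ≤ T s) (h1 : ∑ s, T s = 1)
    (hF : ∀ s, F s → 0 < T s) {a A D z : ℝ} (ha : 0 < a) (hA : 0 < A) (hD : 0 < D) (hz : 0 < z)
    (hFa : ∀ s, F s → secondRatio T s ∈ Set.Icc a A) (hFD : ∀ s, F s → firstRatio T s ≤ D)
    {M₁ M₂ : ℕ} (hM₁ : 0 < M₁) (hM₂ : 0 < M₂) :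
    ∃ (c : Fin M₂ → V) (φ : Y → Fin M₁ → Fin M₂ × W),
      ∑ b : X × Y with ∀ m, ¬ F (b.1, b.2, (φ b.2 m).2, c (φ b.2 m).1),
          margAC (secondLink T) b () ≤
        ∑ s with ¬ F s, T s + (1 / z + A / M₂ + z * A * D / (a * M₁)) := by
  have _ : (0 : ℝ) < M₁ := Nat.cast_pos.2 hM₁
  have _ : (0 : ℝ) < M₂ := Nat.cast_pos.2 hM₂
  let κ : ℝ := M₁ * a / (z * M₂ * D)
  let m (b : X × Y) : ℝ := ∑ v, ∑ w with F (b.1, b.2, w, v), T (b.1, b.2, w, v)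
  have hm (b : X × Y) : m b ≤ margAC (secondLink T) b () := Finset.sum_le_sum fun v _ =>
    Finset.sum_le_sum_of_subset_of_nonneg (Finset.filter_subset _ _) fun w _ _ => h0 _
  have hone : ∑ b : X × Y, margAC (secondLink T) b () = 1 := by
    rw [← h1, ← margC_secondLink]
    rfl
  have hmiss : ∑ b, (margAC (secondLink T) b () - m b) = ∑ s with ¬ F s, T s := by
    rw [Finset.sum_sub_distrib, hone, ← h1, sub_eq_iff_eq_add',
      ← Finset.sum_filter_add_sum_filter_not _ F]
    congr 1
    simp only [m, Finset.sum_filter, Fintype.sum_prod_type]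
    exact Finset.sum_congr rfl fun x _ => Finset.sum_congr rfl fun y _ => Finset.sum_comm
  have hq1 : ∑ v, margBC (secondLink T) v () = 1 := by rw [sum_margBC, margC_secondLink, h1]
  obtain ⟨c, hc⟩ := exists_codebook_sum_exp_le
    (fun b => Finset.sum_nonneg fun v _ => Finset.sum_nonneg fun w _ => h0 _) hm
    (fun v => margBC_nonneg (secondLink_nonneg h0) v ()) hq1 (completionProb_nonneg h0 F)
    (completionProb_le_one h0 F) hA (show 0 < κ by positivity)
    (sum_filter_le_completionProb h0 h1 hF fun s hs => (hFa s hs).2) hM₂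
  obtain ⟨φ, hφ⟩ := exists_lists_of_codebook h0 h1 hF hD hz (fun s hs => (hFa s hs).1) hFD M₁ hM₂ c
  refine ⟨c, φ, hφ.trans ((add_le_add_right hc _).trans_eq ?_)⟩
  rw [hmiss, hone]
  simp only [κ]
  field_simp
  ring

end CascadeCovering

section BlockLaw

variable {A B C A' B' C' : Type*} [Fintype A] [Fintype B] [Fintype A'] [Fintype B'] {n : ℕ}

omit [Fintype A] [Fintype A'] in
theorem margAC_prod (p : A × B × C → ℝ) (eA : A' → Fin n → A) (eB : B' ≃ (Fin n → B))
    (eC : C' → Fin n → C) (a : A') (c : C') :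
    margAC (fun s : A' × B' × C' => ∏ i, p (eA s.1 i, eB s.2.1 i, eC s.2.2 i)) a c =
      ∏ i, margAC p (eA a i) (eC c i) :=
  (eB.sum_comp fun b => ∏ i, p (eA a i, b i, eC c i)).trans
    (sum_prod_seq fun i b => p (eA a i, b, eC c i))

omit [Fintype B] [Fintype B'] in
theorem margBC_prod (p : A × B × C → ℝ) (eA : A' ≃ (Fin n → A)) (eB : B' → Fin n → B)
    (eC : C' → Fin n → C) (b : B') (c : C') :
    margBC (fun s : A' × B' × C' => ∏ i, p (eA s.1 i, eB s.2.1 i, eC s.2.2 i)) b c =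
      ∏ i, margBC p (eB b i) (eC c i) :=
  (eA.sum_comp fun a => ∏ i, p (a i, eB b i, eC c i)).trans
    (sum_prod_seq fun i a => p (a, eB b i, eC c i))

theorem margC_prod (p : A × B × C → ℝ) (eA : A' ≃ (Fin n → A)) (eB : B' ≃ (Fin n → B))
    (eC : C' → Fin n → C) (c : C') :
    margC (fun s : A' × B' × C' => ∏ i, p (eA s.1 i, eB s.2.1 i, eC s.2.2 i)) c =
      ∏ i, margC p (eC c i) :=
  calc _ = ∑ a, ∏ i, margAC p (eA a i) (eC c i) :=
        Finset.sum_congr rfl fun a _ => margAC_prod p eA eB eC a c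
    _ = _ := (eA.sum_comp fun a => ∏ i, margAC p (a i) (eC c i)).trans
        (sum_prod_seq fun i a => margAC p a (eC c i))

theorem infoRatio_prod (p : A × B × C → ℝ) (eA : A' ≃ (Fin n → A)) (eB : B' ≃ (Fin n → B))
    (eC : C' → Fin n → C) (s : A' × B' × C') :
    infoRatio (fun s : A' × B' × C' => ∏ i, p (eA s.1 i, eB s.2.1 i, eC s.2.2 i)) s =
      ∏ i, infoRatio p (eA s.1 i, eB s.2.1 i, eC s.2.2 i) := by
  simp only [infoRatio, margAC_prod p eA eB eC, margBC_prod p eA eB eC, margC_prod p eA eB eC,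
    Finset.prod_div_distrib, Finset.prod_mul_distrib]

variable {X Y W V : Type*}

/-- The sequence of quadruples of letters formed by a quadruple of sequences. -/
def letters (s : (Fin n → X) × (Fin n → Y) × (Fin n → W) × (Fin n → V)) (i : Fin n) :
    X × Y × W × V :=
  (s.1 i, s.2.1 i, s.2.2.1 i, s.2.2.2 i)

/-- The law of `n` independent copies of `(x, y, w, v)`, as a law on quadruples of sequences: the
alphabets of a single use of the cascade at blocklength `n`. -/
def blockLaw (T : X × Y × W × V → ℝ) (n : ℕ)
    (s : (Fin n → X) × (Fin n → Y) × (Fin n → W) × (Fin n → V)) : ℝ :=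
  ∏ i, T (letters s i)

variable {T : X × Y × W × V → ℝ}

theorem blockLaw_nonneg (h0 : ∀ s, 0 ≤ T s)
    (s : (Fin n → X) × (Fin n → Y) × (Fin n → W) × (Fin n → V)) : 0 ≤ blockLaw T n s :=
  Finset.prod_nonneg fun _ _ => h0 _

theorem pos_of_blockLaw_pos (h0 : ∀ s, 0 ≤ T s)
    {s : (Fin n → X) × (Fin n → Y) × (Fin n → W) × (Fin n → V)} (h : 0 < blockLaw T n s)
    (i : Fin n) : 0 < T (letters s i) :=
  (h0 _).lt_of_ne' (Finset.prod_ne_zero_iff.1 h.ne' i (Finset.mem_univ i))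

variable [Fintype W]

theorem secondLink_blockLaw (T : X × Y × W × V → ℝ) :
    secondLink (blockLaw T n) = fun s => ∏ i, secondLink T
      ((Equiv.arrowProdEquivProdArrow (Fin n) (fun _ => X) (fun _ => Y)).symm s.1 i,
        Equiv.refl (Fin n → V) s.2.1 i, ()) :=
  funext fun s => sum_prod_seq fun i w => T (s.1.1 i, s.1.2 i, w, s.2.1 i)

variable [Fintype X] [Fintype V]

theorem firstRatio_blockLaw (T : X × Y × W × V → ℝ)
    (s : (Fin n → X) × (Fin n → Y) × (Fin n → W) × (Fin n → V)) :
    firstRatio (blockLaw T n) s = ∏ i, firstRatio T (letters s i) :=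
  infoRatio_prod (firstLink T) (Equiv.refl _)
    (Equiv.arrowProdEquivProdArrow (Fin n) (fun _ => W) (fun _ => V)).symm id _

omit [Fintype X] in
theorem margAC_secondLink_blockLaw (T : X × Y × W × V → ℝ) (b : (Fin n → X) × (Fin n → Y)) :
    margAC (secondLink (blockLaw T n)) b () = ∏ i, margAC (secondLink T) (b.1 i, b.2 i) () := by
  rw [secondLink_blockLaw]
  exact margAC_prod (secondLink T) _ (Equiv.refl _) (fun _ : Unit => fun _ => ()) b ()

variable [Fintype Y]

theorem secondRatio_blockLaw (T : X × Y × W × V → ℝ)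
    (s : (Fin n → X) × (Fin n → Y) × (Fin n → W) × (Fin n → V)) :
    secondRatio (blockLaw T n) s = ∏ i, secondRatio T (letters s i) := by
  rw [secondRatio, secondLink_blockLaw]
  exact infoRatio_prod (secondLink T) _ (Equiv.refl _) (fun _ : Unit => fun _ => ()) _

theorem sum_comp_letters (f : (Fin n → X × Y × W × V) → ℝ) :
    ∑ s : (Fin n → X) × (Fin n → Y) × (Fin n → W) × (Fin n → V), f (letters s) = ∑ t, f t :=
  Equiv.sum_comp (e := ⟨letters, fun t => (fun i => (t i).1, fun i => (t i).2.1,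
    fun i => (t i).2.2.1, fun i => (t i).2.2.2), fun _ => rfl, fun _ => rfl⟩) f

theorem sum_blockLaw (h1 : ∑ s, T s = 1) : ∑ s, blockLaw T n s = 1 := by
  simp only [blockLaw]
  rw [sum_comp_letters fun t => ∏ i, T (t i), sum_prod_seq fun _ => T]
  simp [h1]

end BlockLaw

section Codes

variable {X Y X₁ X₂ : Type*} [Fintype X] [Fintype Y] [Fintype X₁] [Fintype X₂] {n M₁ M₂ : ℕ}

open Classical in
theorem CascadeCode.errorProb_eq_sum (C : CascadeCode X Y X₁ X₂ n M₁ M₂) (P₀ : stdSimplex ℝ (X × Y))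
    (T : X × Y × X₁ × X₂ → ℝ) (ε : ℝ) :
    C.errorProb P₀ T ε = ∑ b : (Fin n → X) × (Fin n → Y) with
      ε < tvDist (empiricalDist (C.output b.1 b.2)) T, ∏ i, P₀ (b.1 i, b.2 i) := by
  rw [Finset.sum_filter, Fintype.sum_prod_type]
  rfl

theorem CascadeCode.errorProb_nonneg (C : CascadeCode X Y X₁ X₂ n M₁ M₂) (P₀ : stdSimplex ℝ (X × Y))
    (T : X × Y × X₁ × X₂ → ℝ) (ε : ℝ) : 0 ≤ C.errorProb P₀ T ε := by
  rw [CascadeCode.errorProb_eq_sum]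
  exact Finset.sum_nonneg fun b _ => Finset.prod_nonneg fun i _ => P₀.2.1 _

theorem CascadeCode.errorProb_anti (C : CascadeCode X Y X₁ X₂ n M₁ M₂) (P₀ : stdSimplex ℝ (X × Y))
    {T T' : X × Y × X₁ × X₂ → ℝ} {ε ε' : ℝ} (h : ε + tvDist T T' ≤ ε') :
    C.errorProb P₀ T' ε' ≤ C.errorProb P₀ T ε := by
  classical
  rw [CascadeCode.errorProb_eq_sum, CascadeCode.errorProb_eq_sum]
  refine Finset.sum_le_sum_of_subset_of_nonneg (fun b hb => ?_)
    fun b _ _ => Finset.prod_nonneg fun i _ => P₀.2.1 _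
  simp only [Finset.mem_filter, Finset.mem_univ, true_and] at hb ⊢
  linarith [tvDist_triangle (empiricalDist (C.output b.1 b.2)) T T']

open Classical in
theorem exists_errorProb_le_of_lists (hM₁ : 0 < M₁) (P₀ : stdSimplex ℝ (X × Y))
    {T : X × Y × X₁ × X₂ → ℝ} {ε : ℝ}
    {F : (Fin n → X) × (Fin n → Y) × (Fin n → X₁) × (Fin n → X₂) → Prop}
    (hF : ∀ s, F s → tvDist (empiricalDist (letters s)) T ≤ ε)
    (c : Fin M₂ → Fin n → X₂) (φ : (Fin n → Y) → Fin M₁ → Fin M₂ × (Fin n → X₁)) :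
    ∃ C : CascadeCode X Y X₁ X₂ n M₁ M₂, C.errorProb P₀ T ε ≤
      ∑ b : (Fin n → X) × (Fin n → Y) with ∀ m, ¬ F (b.1, b.2, (φ b.2 m).2, c (φ b.2 m).1),
        ∏ i, P₀ (b.1 i, b.2 i) := by
  have : Nonempty (Fin M₁) := ⟨⟨0, hM₁⟩⟩
  choose! enc henc using fun (b : (Fin n → X) × (Fin n → Y))
    (h : ∃ m, F (b.1, b.2, (φ b.2 m).2, c (φ b.2 m).1)) => h
  refine ⟨⟨fun x y => enc (x, y), fun y m => (φ y m).1, fun y m => (φ y m).2, c⟩, ?_⟩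
  rw [CascadeCode.errorProb_eq_sum]
  refine Finset.sum_le_sum_of_subset_of_nonneg (fun b hb => ?_)
    fun b _ _ => Finset.prod_nonneg fun i _ => P₀.2.1 _
  simp only [Finset.mem_filter, Finset.mem_univ, true_and] at hb ⊢
  exact fun m hm => (hF _ (henc b ⟨m, hm⟩)).not_gt hb

end Codes

section NumMessages

theorem numMessages_pos (n : ℕ) {R : ℝ} (hR : 0 ≤ R) : 0 < numMessages n R :=
  (Nat.one_le_floor_iff _).2 (Real.one_le_rpow one_le_two (by positivity))

theorem numMessages_le (n : ℕ) (R : ℝ) : (numMessages n R : ℝ) ≤ 2 ^ (n * R) :=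
  Nat.floor_le (by positivity)

theorem rpow_le_two_mul_numMessages (n : ℕ) {R : ℝ} (hR : 0 ≤ R) :
    (2 : ℝ) ^ (n * R) ≤ 2 * numMessages n R := by
  have hone : (1 : ℝ) ≤ numMessages n R := by exact_mod_cast numMessages_pos n hR
  have hfloor : (2 : ℝ) ^ (n * R) < numMessages n R + 1 := Nat.lt_floor_add_one _
  linarith

theorem rpow_div_numMessages_le (n : ℕ) {R a b : ℝ} (hR : 0 ≤ R) (h : a + b ≤ R) :
    (2 : ℝ) ^ (n * a) / numMessages n R ≤ 2 * (2 : ℝ) ^ (-(n * b)) := by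
  rw [div_le_iff₀ (by exact_mod_cast numMessages_pos n hR)]
  calc (2 : ℝ) ^ (n * a) ≤ 2 ^ (-(n * b) + n * R) :=
        Real.rpow_le_rpow_of_exponent_le one_le_two (by
          linarith [mul_le_mul_of_nonneg_left h (Nat.cast_nonneg (α := ℝ) n)])
    _ = 2 ^ (-(n * b)) * 2 ^ (n * R) := Real.rpow_add two_pos _ _
    _ ≤ 2 ^ (-(n * b)) * (2 * numMessages n R) := by
        gcongr
        exact rpow_le_two_mul_numMessages n hR
    _ = _ := by ring

theorem covering_error_le (n : ℕ) {I₁ I₂ R₁ R₂ δ : ℝ} (hR₁0 : 0 ≤ R₁) (hR₂0 : 0 ≤ R₂)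
    (hR₁ : I₁ + 5 * δ ≤ R₁) (hR₂ : I₂ + 2 * δ ≤ R₂) :
    1 / (2 : ℝ) ^ (n * δ) + 2 ^ (n * (I₂ + δ)) / numMessages n R₂ +
        2 ^ (n * δ) * 2 ^ (n * (I₂ + δ)) * 2 ^ (n * (I₁ + δ)) /
          (2 ^ (n * (I₂ - δ)) * numMessages n R₁) ≤ 5 * 2 ^ (-(n * δ)) := by
  have hlist : (2 : ℝ) ^ (n * δ) * 2 ^ (n * (I₂ + δ)) * 2 ^ (n * (I₁ + δ)) /
      (2 ^ (n * (I₂ - δ)) * numMessages n R₁) = 2 ^ (n * (I₁ + 4 * δ)) / numMessages n R₁ := by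
    rw [← div_div, ← Real.rpow_add two_pos, ← Real.rpow_add two_pos, ← Real.rpow_sub two_pos]
    ring_nf
  have hmiss := rpow_div_numMessages_le n (a := I₁ + 4 * δ) (b := δ) hR₁0 (by linarith)
  have hcode := rpow_div_numMessages_le n (a := I₂ + δ) (b := δ) hR₂0 (by linarith)
  have hz : 1 / (2 : ℝ) ^ (n * δ) = 2 ^ (-(n * δ)) := by rw [Real.rpow_neg two_pos.le, one_div]
  linarith

end NumMessages

theorem exists_forall_abs_le {S : Type*} [Finite S] (f : S → ℝ) :
    ∃ C, 0 ≤ C ∧ ∀ s, |f s| ≤ C := by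
  obtain ⟨C, hC⟩ := (Set.finite_range fun s => |f s|).bddAbove
  exact ⟨max 0 C, le_max_left _ _, fun s => (hC ⟨s, rfl⟩).trans (le_max_right _ _)⟩

section Typical

variable {X Y W V : Type*} [Fintype X] [Fintype Y] [Fintype W] [Fintype V] {n : ℕ}
  {T : X × Y × W × V → ℝ}

/-- The quadruple of sequences `s` is jointly typical: it has positive probability and its joint
type is within total variation distance `ε` of `T`. -/
def IsTypical (T : X × Y × W × V → ℝ) (ε : ℝ)
    (s : (Fin n → X) × (Fin n → Y) × (Fin n → W) × (Fin n → V)) : Prop :=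
  tvDist (empiricalDist (letters s)) T ≤ ε ∧ 0 < blockLaw T n s

open Classical in
theorem sum_blockLaw_not_isTypical_le (h0 : ∀ s, 0 ≤ T s) (h1 : ∑ s, T s = 1) (hn : 0 < n)
    {ε : ℝ} (hε : 0 < ε) :
    ∑ s with ¬ IsTypical T ε s, blockLaw T n s ≤
      Fintype.card (X × Y × W × V) ^ 3 / (16 * (n * ε ^ 2)) := by
  refine le_trans ?_ (sum_prod_of_lt_tvDist_le (n := n) h0 h1 hn hε)
  rw [Finset.sum_filter, Finset.sum_filter, ← sum_comp_letters]
  refine Finset.sum_le_sum fun s _ => ?_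
  rcases lt_or_ge ε (tvDist (empiricalDist (letters s)) T) with htv | htv
  · rw [if_pos htv, if_pos fun hs => hs.1.not_gt htv]
    rfl
  · rw [if_neg htv.not_gt]
    split_ifs with hs
    · rfl
    · exact not_lt.1 fun hpos => hs ⟨htv, hpos⟩

variable {ε C δ : ℝ} {s : (Fin n → X) × (Fin n → Y) × (Fin n → W) × (Fin n → V)}

theorem IsTypical.prod_mem_Icc {r : X × Y × W × V → ℝ} (hs : IsTypical T ε s)
    (h0 : ∀ a, 0 ≤ T a) (hr : ∀ a, 0 < T a → 0 < r a) (hC0 : 0 ≤ C)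
    (hC : ∀ a, |Real.logb 2 (r a)| ≤ C) (hε : 2 * C * ε ≤ δ) :
    ∏ i, r (letters s i) ∈ Set.Icc ((2 : ℝ) ^ (n * (∑ a, T a * Real.logb 2 (r a) - δ)))
      ((2 : ℝ) ^ (n * (∑ a, T a * Real.logb 2 (r a) + δ))) :=
  prod_mem_Icc_of_tvDist_le (fun i => hr _ (pos_of_blockLaw_pos h0 hs.2 i)) hC
    ((mul_le_mul_of_nonneg_left hs.1 (by positivity)).trans hε)

theorem IsTypical.firstRatio_le (hs : IsTypical T ε s) (h0 : ∀ a, 0 ≤ T a) (hC0 : 0 ≤ C)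
    (hC : ∀ a, |Real.logb 2 (firstRatio T a)| ≤ C) (hε : 2 * C * ε ≤ δ) :
    firstRatio (blockLaw T n) s ≤ 2 ^ (n * (condMutualInfo (firstLink T) + δ)) := by
  rw [firstRatio_blockLaw, condMutualInfo_firstLink]
  exact (hs.prod_mem_Icc h0 (fun _ => firstRatio_pos h0) hC0 hC hε).2

theorem IsTypical.secondRatio_mem_Icc (hs : IsTypical T ε s) (h0 : ∀ a, 0 ≤ T a) (hC0 : 0 ≤ C)
    (hC : ∀ a, |Real.logb 2 (secondRatio T a)| ≤ C) (hε : 2 * C * ε ≤ δ) :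
    secondRatio (blockLaw T n) s ∈
      Set.Icc ((2 : ℝ) ^ (n * (condMutualInfo (secondLink T) - δ)))
        (2 ^ (n * (condMutualInfo (secondLink T) + δ))) := by
  rw [secondRatio_blockLaw, condMutualInfo_secondLink]
  exact hs.prod_mem_Icc h0 (fun _ => secondRatio_pos h0) hC0 hC hε

end Typical

section Direct

variable {X Y X₁ X₂ : Type*} [Fintype X] [Fintype Y] [Fintype X₁] [Fintype X₂]

theorem targetDist_nonneg (P₀ : stdSimplex ℝ (X × Y)) (Q : X × Y → stdSimplex ℝ (X₁ × X₂))
    (s : X × Y × X₁ × X₂) : 0 ≤ targetDist P₀ Q s :=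
  mul_nonneg (P₀.2.1 _) ((Q _).2.1 _)

theorem margAC_secondLink_targetDist (P₀ : stdSimplex ℝ (X × Y))
    (Q : X × Y → stdSimplex ℝ (X₁ × X₂)) (b : X × Y) :
    margAC (secondLink (targetDist P₀ Q)) b () = P₀ b := by
  have hQ : ∑ w, ∑ v, Q b (w, v) = 1 := (Fintype.sum_prod_type _).symm.trans (Q b).2.2
  simp only [margAC, secondLink, targetDist, ← Finset.mul_sum]
  rw [Finset.sum_comm, hQ, mul_one]

theorem sum_targetDist (P₀ : stdSimplex ℝ (X × Y)) (Q : X × Y → stdSimplex ℝ (X₁ × X₂)) :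
    ∑ s, targetDist P₀ Q s = 1 := by
  rw [← margC_secondLink]
  exact (Finset.sum_congr rfl fun b _ => margAC_secondLink_targetDist P₀ Q b).trans P₀.2.2

theorem exists_errorProb_le (P₀ : stdSimplex ℝ (X × Y)) (Q : X × Y → stdSimplex ℝ (X₁ × X₂))
    {R₁ R₂ δ C : ℝ} (hδ : 0 ≤ δ) (hR₁ : condMutualInfo (firstLink (targetDist P₀ Q)) + 5 * δ ≤ R₁)
    (hR₂ : condMutualInfo (secondLink (targetDist P₀ Q)) + 2 * δ ≤ R₂) (hC0 : 0 ≤ C)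
    (hC₁ : ∀ s, |Real.logb 2 (firstRatio (targetDist P₀ Q) s)| ≤ C)
    (hC₂ : ∀ s, |Real.logb 2 (secondRatio (targetDist P₀ Q) s)| ≤ C)
    {n : ℕ} (hn : 0 < n) {ε : ℝ} (hε : 0 < ε) (hCε : 2 * C * ε ≤ δ) :
    ∃ K : CascadeCode X Y X₁ X₂ n (numMessages n R₁) (numMessages n R₂),
      K.errorProb P₀ (targetDist P₀ Q) ε ≤
        Fintype.card (X × Y × X₁ × X₂) ^ 3 / (16 * (n * ε ^ 2)) + 5 * 2 ^ (-(n * δ)) := by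
  classical
  have h0 := targetDist_nonneg P₀ Q
  have h1 := sum_targetDist P₀ Q
  have hR₁0 : 0 ≤ R₁ := by
    linarith [condMutualInfo_nonneg (p := firstLink (targetDist P₀ Q)) fun _ => h0 _]
  have hR₂0 : 0 ≤ R₂ := by linarith [condMutualInfo_nonneg (secondLink_nonneg h0)]
  have hM₁ := numMessages_pos n hR₁0
  obtain ⟨c, φ, hφ⟩ := exists_cascade_covering (z := 2 ^ (n * δ)) (blockLaw_nonneg (n := n) h0)
    (sum_blockLaw h1) (fun s (hs : IsTypical (targetDist P₀ Q) ε s) => hs.2) (by positivity)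
    (by positivity) (by positivity) (by positivity)
    (fun s hs => hs.secondRatio_mem_Icc h0 hC0 hC₂ hCε)
    (fun s hs => hs.firstRatio_le h0 hC0 hC₁ hCε) hM₁ (numMessages_pos n hR₂0)
  obtain ⟨K, hK⟩ := exists_errorProb_le_of_lists hM₁ P₀
    (fun s (hs : IsTypical (targetDist P₀ Q) ε s) => hs.1) c φ
  refine ⟨K, hK.trans ?_⟩
  simp only [margAC_secondLink_blockLaw, margAC_secondLink_targetDist] at hφ
  exact hφ.trans (add_le_add (sum_blockLaw_not_isTypical_le h0 h1 hn hε)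
    (covering_error_le n hR₁0 hR₂0 hR₁ hR₂))

theorem achievable_of_eventually {P₀ : stdSimplex ℝ (X × Y)} {Q : X × Y → stdSimplex ℝ (X₁ × X₂)}
    {R : ℝ × ℝ}
    (hne : ∀ n, Nonempty (CascadeCode X Y X₁ X₂ n (numMessages n R.1) (numMessages n R.2)))
    {ε u : ℕ → ℝ} (hε : Tendsto ε atTop (𝓝 0)) (hu : Tendsto u atTop (𝓝 0))
    (h : ∀ᶠ n in atTop,
      ∃ K : CascadeCode X Y X₁ X₂ n (numMessages n R.1) (numMessages n R.2),
        K.errorProb P₀ (targetDist P₀ Q) (ε n) ≤ u n) : Achievable P₀ Q R := by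
  obtain ⟨K, hK⟩ := skolem.1 h
  refine ⟨K, fun ε' hε' => squeeze_zero'
    (.of_forall fun n => CascadeCode.errorProb_nonneg _ _ _ _) ?_ hu⟩
  filter_upwards [hK, hε.eventually (ge_mem_nhds hε')] with n hn hle
  exact (CascadeCode.errorProb_anti (K n) P₀ (by rwa [tvDist_self, add_zero])).trans hn

theorem tendsto_typicality_error (a : ℝ) {δ : ℝ} (hδ : 0 < δ) :
    Tendsto (fun n : ℕ => a / (16 * (n * (√√(n : ℝ))⁻¹ ^ 2)) + 5 * (2 : ℝ) ^ (-(n * δ)))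
      atTop (𝓝 0) := by
  have hsqrt (n : ℕ) : (n : ℝ) * (√√(n : ℝ))⁻¹ ^ 2 = √n := by
    rw [inv_pow, Real.sq_sqrt (Real.sqrt_nonneg _), ← div_eq_mul_inv, Real.div_sqrt]
  have hpoly : Tendsto (fun n : ℕ => a / (16 * √(n : ℝ))) atTop (𝓝 0) :=
    ((Real.tendsto_sqrt_atTop.comp tendsto_natCast_atTop_atTop).const_mul_atTop
      (by norm_num)).const_div_atTop a
  have hexp : Tendsto (fun n : ℕ => (2 : ℝ) ^ (-(n * δ))) atTop (𝓝 0) :=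
    (tendsto_rpow_atBot_of_base_gt_one 2 one_lt_two).comp
      (tendsto_neg_atTop_atBot.comp (tendsto_natCast_atTop_atTop.atTop_mul_const hδ))
  simpa only [hsqrt, mul_zero, add_zero] using hpoly.add (hexp.const_mul 5)

theorem nonempty_cascadeCode (P₀ : stdSimplex ℝ (X × Y)) (Q : X × Y → stdSimplex ℝ (X₁ × X₂))
    {n M₁ M₂ : ℕ} (hM₁ : 0 < M₁) (hM₂ : 0 < M₂) : Nonempty (CascadeCode X Y X₁ X₂ n M₁ M₂) := by
  have hne : Nonempty (X × Y × X₁ × X₂) := by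
    by_contra hempty
    rw [not_nonempty_iff] at hempty
    simpa using sum_targetDist P₀ Q
  obtain ⟨-, -, w, v⟩ := hne
  exact ⟨⟨fun _ _ => ⟨0, hM₁⟩, fun _ _ => ⟨0, hM₂⟩, fun _ _ _ => w, fun _ _ => v⟩⟩

theorem achievable_of_lt {P₀ : stdSimplex ℝ (X × Y)} {Q : X × Y → stdSimplex ℝ (X₁ × X₂)}
    {R : ℝ × ℝ} (hR₁ : condMutualInfo (firstLink (targetDist P₀ Q)) < R.1)
    (hR₂ : condMutualInfo (secondLink (targetDist P₀ Q)) < R.2) : Achievable P₀ Q R := by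
  have h0 := targetDist_nonneg P₀ Q
  have hM₁ (n : ℕ) : 0 < numMessages n R.1 :=
    numMessages_pos n ((condMutualInfo_nonneg (p := firstLink (targetDist P₀ Q))
      fun _ => h0 _).trans hR₁.le)
  have hM₂ (n : ℕ) : 0 < numMessages n R.2 :=
    numMessages_pos n ((condMutualInfo_nonneg (secondLink_nonneg h0)).trans hR₂.le)
  obtain ⟨C₁, hC₁0, hC₁⟩ :=
    exists_forall_abs_le fun s => Real.logb 2 (firstRatio (targetDist P₀ Q) s)
  obtain ⟨C₂, -, hC₂⟩ :=
    exists_forall_abs_le fun s => Real.logb 2 (secondRatio (targetDist P₀ Q) s)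
  obtain ⟨δ, hδ, hδR⟩ := exists_between
    (lt_min (div_pos (sub_pos.2 hR₁) (by norm_num : (0 : ℝ) < 5)) (div_pos (sub_pos.2 hR₂) two_pos))
  obtain ⟨hδ₁, hδ₂⟩ := lt_min_iff.1 hδR
  have hε : Tendsto (fun n : ℕ => (√√(n : ℝ))⁻¹) atTop (𝓝 0) :=
    tendsto_inv_atTop_zero.comp (Real.tendsto_sqrt_atTop.comp
      (Real.tendsto_sqrt_atTop.comp tendsto_natCast_atTop_atTop))
  have hCε : Tendsto (fun n : ℕ => 2 * max C₁ C₂ * (√√(n : ℝ))⁻¹) atTop (𝓝 0) := by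
    simpa only [mul_zero] using hε.const_mul (2 * max C₁ C₂)
  refine achievable_of_eventually (fun n => nonempty_cascadeCode P₀ Q (hM₁ n) (hM₂ n)) hε
    (tendsto_typicality_error (Fintype.card (X × Y × X₁ × X₂) ^ 3) hδ) ?_
  filter_upwards [eventually_gt_atTop 0, hCε.eventually (ge_mem_nhds hδ)] with n hn hCn
  exact exists_errorProb_le P₀ Q hδ.le (by linarith) (by linarith) (hC₁0.trans (le_max_left _ _))
    (fun s => (hC₁ s).trans (le_max_left _ _)) (fun s => (hC₂ s).trans (le_max_right _ _)) hn
    (by positivity) hCn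

end Direct

section RateBound

theorem le_add_logb_of_eventually {c R b : ℝ} (hb : 0 < b)
    (h : ∀ᶠ n : ℕ in atTop, (2 : ℝ) ^ (n * c) / 2 ≤ numMessages n R * b ^ n) :
    c ≤ R + Real.logb 2 b := by
  have hlim : Tendsto (fun n : ℕ => c - 1 / (n : ℝ)) atTop (𝓝 c) := by
    simpa using tendsto_one_div_atTop_nhds_zero_nat.const_sub c
  refine le_of_tendsto hlim ?_
  filter_upwards [h, eventually_gt_atTop 0] with n hn hpos
  have hpow : (2 : ℝ) ^ (n * c - 1) ≤ 2 ^ (n * R + n * Real.logb 2 b) := calc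
    (2 : ℝ) ^ (n * c - 1) = 2 ^ (n * c) / 2 := by rw [Real.rpow_sub_one two_ne_zero]
    _ ≤ 2 ^ (n * R) * b ^ n := hn.trans (by gcongr; exact numMessages_le n R)
    _ = 2 ^ (n * R + n * Real.logb 2 b) := by
      rw [Real.rpow_add two_pos, mul_comm (n : ℝ) (Real.logb 2 b),
        Real.rpow_mul two_pos.le (Real.logb 2 b), Real.rpow_logb two_pos (by norm_num) hb,
        Real.rpow_natCast]
  have hexp := (Real.rpow_le_rpow_left_iff one_lt_two).1 hpow
  have hn0 : (0 : ℝ) < n := by exact_mod_cast hpos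
  rw [sub_le_iff_le_add, ← sub_le_iff_le_add', le_div_iff₀ hn0]
  linarith

variable {S : Type*} [Fintype S] {T r : S → ℝ} {R : ℝ}

theorem sum_mul_logb_le_of_forall_add_le (h0 : ∀ s, 0 ≤ T s) (hr : ∀ s, 0 < T s → 0 < r s)
    (h : ∀ η > 0, ∑ s, T s * Real.logb 2 (r s + η) ≤ R + Real.logb 2 (1 + η)) :
    ∑ s, T s * Real.logb 2 (r s) ≤ R := by
  have hlim : Tendsto (fun η : ℝ => R + Real.logb 2 (1 + η)) (𝓝[>] 0) (𝓝 R) := by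
    have hcont : ContinuousAt (fun η : ℝ => R + Real.logb 2 (1 + η)) 0 :=
      continuousAt_const.add ((continuousAt_const.add continuousAt_id).logb (by simp))
    simpa using hcont.tendsto.mono_left nhdsWithin_le_nhds
  refine ge_of_tendsto hlim ?_
  filter_upwards [self_mem_nhdsWithin] with η hη
  refine (Finset.sum_le_sum fun s _ => ?_).trans (h η hη)
  rcases (h0 s).eq_or_lt with hs | hs
  · simp [← hs]
  · exact mul_le_mul_of_nonneg_left
      (Real.logb_le_logb_of_le one_lt_two (hr s hs) (le_add_of_nonneg_right (le_of_lt hη))) hs.le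

theorem sum_mul_logb_le_of_forall_typical {b : ℝ} (hr : ∀ s, 0 < r s) (hb : 0 < b)
    (h : ∀ γ > 0, ∃ R' ≤ R + γ, ∀ᶠ n : ℕ in atTop, ∀ β : ℝ, 0 ≤ β →
      (∀ s : Fin n → S, tvDist (empiricalDist s) T ≤ γ → β ≤ ∏ i, r (s i)) →
        β / 2 ≤ numMessages n R' * b ^ n) :
    ∑ s, T s * Real.logb 2 (r s) ≤ R + Real.logb 2 b := by
  obtain ⟨C, hC0, hC⟩ := exists_forall_abs_le fun s => Real.logb 2 (r s)
  have hγ (γ : ℝ) (hγ0 : 0 < γ) :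
      ∑ s, T s * Real.logb 2 (r s) - 2 * C * γ ≤ R + γ + Real.logb 2 b := by
    obtain ⟨R', hR', hn⟩ := h γ hγ0
    refine le_trans ?_ (add_le_add_left hR' _)
    refine le_add_logb_of_eventually hb ?_
    filter_upwards [hn] with n hn
    exact hn _ (by positivity) fun s hs => (prod_mem_Icc_of_tvDist_le (fun i => hr _) hC
      (mul_le_mul_of_nonneg_left hs (by positivity))).1
  refine le_of_forall_pos_le_add fun e he => ?_
  have hscale : 2 * C * (e / (2 * C + 1)) + e / (2 * C + 1) = e := by field_simp
  linarith [hγ (e / (2 * C + 1)) (by positivity)]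

end RateBound

section UnionBound

open Classical in
-- Each message is a good description of few source blocks in the `μ`-weighted sense `hκ`.
theorem half_le_card_mul {Ω ι : Type*} [Fintype Ω] [Fintype ι] {μ : Ω → ℝ} (hμ : ∀ ω, 0 ≤ μ ω)
    (h1 : ∑ ω, μ ω = 1) {ρ : ι → Ω → ℝ} (hρ : ∀ m ω, 0 ≤ ρ m ω) {κ : ℝ}
    (hκ : ∀ m, ∑ ω, μ ω * ρ m ω ≤ κ) {bad : Ω → Prop} (hbad : ∑ ω with bad ω, μ ω ≤ 1 / 2)
    {β : ℝ} (hβ0 : 0 ≤ β) (enc : Ω → ι) (hβ : ∀ ω, ¬ bad ω → β ≤ ρ (enc ω) ω) :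
    β / 2 ≤ Fintype.card ι * κ := by
  have hgood : 1 / 2 ≤ ∑ ω with ¬ bad ω, μ ω := by
    linarith [Finset.sum_filter_add_sum_filter_not Finset.univ bad μ]
  calc β / 2 ≤ ∑ ω with ¬ bad ω, μ ω * β := by
        rw [← Finset.sum_mul]
        linarith [mul_le_mul_of_nonneg_right hgood hβ0]
    _ ≤ ∑ ω with ¬ bad ω, μ ω * ∑ m, ρ m ω := Finset.sum_le_sum fun ω hω =>
        mul_le_mul_of_nonneg_left ((hβ ω (Finset.mem_filter.1 hω).2).trans
          (Finset.single_le_sum (f := fun m => ρ m ω) (fun m _ => hρ m ω)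
            (Finset.mem_univ (enc ω)))) (hμ ω)
    _ ≤ ∑ ω, μ ω * ∑ m, ρ m ω := Finset.sum_le_sum_of_subset_of_nonneg
        (Finset.filter_subset _ _) fun ω _ _ =>
          mul_nonneg (hμ ω) (Finset.sum_nonneg fun m _ => hρ m ω)
    _ = ∑ m, ∑ ω, μ ω * ρ m ω := by
        simp only [Finset.mul_sum]
        exact Finset.sum_comm
    _ ≤ Fintype.card ι * κ := by
        simpa using Finset.sum_le_card_nsmul Finset.univ _ κ fun m _ => hκ m

theorem sum_sum_prod_margAC_mul_infoRatio_le {A B C : Type*} [Fintype A] [Fintype B] [Fintype C]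
    {p : A × B × C → ℝ} (h0 : ∀ s, 0 ≤ p s) (h1 : ∑ s, p s = 1) {η : ℝ} (hη : 0 ≤ η) {n : ℕ}
    (d : (Fin n → C) → Fin n → B) :
    ∑ c : Fin n → C, ∑ a : Fin n → A,
      ∏ i, margAC p (a i) (c i) * (infoRatio p (a i, d c i, c i) + η) ≤ (1 + η) ^ n := by
  calc _ = ∑ c : Fin n → C, ∏ i, ∑ a, margAC p a (c i) * (infoRatio p (a, d c i, c i) + η) :=
        Finset.sum_congr rfl fun c _ =>
          sum_prod_seq fun i a => margAC p a (c i) * (infoRatio p (a, d c i, c i) + η)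
    _ ≤ ∑ c : Fin n → C, ∏ i, (1 + η) * margC p (c i) :=
        Finset.sum_le_sum fun c _ => Finset.prod_le_prod
          (fun i _ => Finset.sum_nonneg fun a _ => mul_nonneg (margAC_nonneg h0 _ _)
            (add_nonneg (infoRatio_nonneg h0 _) hη))
          fun i _ => sum_margAC_mul_infoRatio_add_le h0 η _ _
    _ = ∏ _i : Fin n, ∑ c, (1 + η) * margC p c := sum_prod_seq fun _ c => (1 + η) * margC p c
    _ = (1 + η) ^ n := by simp [← Finset.mul_sum, sum_margC, h1]

end UnionBound

section Converse

variable {X Y X₁ X₂ : Type*} [Fintype X] [Fintype Y] [Fintype X₁] [Fintype X₂] {n M₁ M₂ : ℕ}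

omit [Fintype X₁] [Fintype X₂] in
theorem sum_pairSeq (f : (Fin n → X × Y) → ℝ) :
    ∑ b : (Fin n → X) × (Fin n → Y), f (fun i => (b.1 i, b.2 i)) = ∑ a, f a :=
  (Equiv.arrowProdEquivProdArrow (Fin n) (fun _ => X) fun _ => Y).symm.sum_comp f

theorem half_le_card_mul_of_errorProb_le {K : CascadeCode X Y X₁ X₂ n M₁ M₂}
    {P₀ : stdSimplex ℝ (X × Y)} {T r : X × Y × X₁ × X₂ → ℝ} (hr : ∀ s, 0 ≤ r s)
    {γ : ℝ} (herr : K.errorProb P₀ T γ ≤ 1 / 2) {M : ℕ}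
    (dec : Fin M → (Fin n → X) × (Fin n → Y) → Fin n → X × Y × X₁ × X₂) {κ : ℝ}
    (hκ : ∀ m, ∑ b : (Fin n → X) × (Fin n → Y),
      (∏ i, P₀ (b.1 i, b.2 i)) * ∏ i, r (dec m b i) ≤ κ)
    (enc : (Fin n → X) × (Fin n → Y) → Fin M)
    (henc : ∀ b i, r (dec (enc b) b i) = r (K.output b.1 b.2 i)) {β : ℝ} (hβ0 : 0 ≤ β)
    (hβ : ∀ s : Fin n → X × Y × X₁ × X₂, tvDist (empiricalDist s) T ≤ γ → β ≤ ∏ i, r (s i)) :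
    β / 2 ≤ M * κ := by
  classical
  rw [CascadeCode.errorProb_eq_sum] at herr
  have hsource : ∑ b : (Fin n → X) × (Fin n → Y), ∏ i, P₀ (b.1 i, b.2 i) = 1 := by
    have hP₀ : ∑ a, P₀ a = 1 := P₀.2.2
    rw [sum_pairSeq fun a => ∏ i, P₀ (a i), sum_prod_seq fun _ => P₀]
    simp [hP₀]
  simpa using half_le_card_mul (fun b => Finset.prod_nonneg fun i _ => P₀.2.1 _) hsource
    (fun m b => Finset.prod_nonneg fun i _ => hr (dec m b i)) hκ herr hβ0 enc fun b hb => by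
      simpa only [henc] using hβ _ (not_lt.1 hb)

variable {K : CascadeCode X Y X₁ X₂ n M₁ M₂} {P₀ : stdSimplex ℝ (X × Y)}
  {Q : X × Y → stdSimplex ℝ (X₁ × X₂)} {γ η β : ℝ}

theorem half_le_mul_of_firstRatio (hη : 0 ≤ η)
    (herr : K.errorProb P₀ (targetDist P₀ Q) γ ≤ 1 / 2) (hβ0 : 0 ≤ β)
    (hβ : ∀ s : Fin n → X × Y × X₁ × X₂, tvDist (empiricalDist s) (targetDist P₀ Q) ≤ γ →
      β ≤ ∏ i, (firstRatio (targetDist P₀ Q) (s i) + η)) :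
    β / 2 ≤ M₁ * (1 + η) ^ n := by
  have h0 := targetDist_nonneg P₀ Q
  refine half_le_card_mul_of_errorProb_le (fun s => add_nonneg (firstRatio_nonneg h0 s) hη) herr
    (fun m b i => (b.1 i, b.2 i, K.g₁ b.2 m i, K.g₂ (K.f₂ b.2 m) i)) (fun m => ?_)
    (fun b => K.f₁ b.1 b.2) (fun _ _ => rfl) hβ0 hβ
  have hsum := sum_sum_prod_margAC_mul_infoRatio_le (p := firstLink (targetDist P₀ Q))
    (fun _ => h0 _) ((sum_firstLink _).trans (sum_targetDist P₀ Q)) hη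
    fun y i => (K.g₁ y m i, K.g₂ (K.f₂ y m) i)
  simp only [margAC_firstLink, margAC_secondLink_targetDist, Finset.prod_mul_distrib] at hsum
  rw [Fintype.sum_prod_type_right]
  exact hsum

theorem half_le_mul_of_secondRatio (hη : 0 ≤ η)
    (herr : K.errorProb P₀ (targetDist P₀ Q) γ ≤ 1 / 2) (hβ0 : 0 ≤ β)
    (hβ : ∀ s : Fin n → X × Y × X₁ × X₂, tvDist (empiricalDist s) (targetDist P₀ Q) ≤ γ →
      β ≤ ∏ i, (secondRatio (targetDist P₀ Q) (s i) + η)) :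
    β / 2 ≤ M₂ * (1 + η) ^ n := by
  have h0 := targetDist_nonneg P₀ Q
  refine half_le_card_mul_of_errorProb_le (fun s => add_nonneg (secondRatio_nonneg h0 s) hη) herr
    (fun m b i => (b.1 i, b.2 i, K.g₁ b.2 (K.f₁ b.1 b.2) i, K.g₂ m i)) (fun m => ?_)
    (fun b => K.f₂ b.2 (K.f₁ b.1 b.2)) (fun _ _ => rfl) hβ0 hβ
  have hsum := sum_sum_prod_margAC_mul_infoRatio_le (p := secondLink (targetDist P₀ Q))
    (secondLink_nonneg h0) ((sum_secondLink _).trans (sum_targetDist P₀ Q)) hη fun _ => K.g₂ m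
  simp only [Finset.prod_mul_distrib, Fintype.sum_unique] at hsum
  rw [← sum_pairSeq] at hsum
  simp only [← margAC_secondLink_targetDist P₀ Q]
  exact hsum

theorem mem_informationRegion_iff {R : ℝ × ℝ} : R ∈ informationRegion P₀ Q ↔
    condMutualInfo (secondLink (targetDist P₀ Q)) ≤ R.2 ∧
      condMutualInfo (firstLink (targetDist P₀ Q)) ≤ R.1 := by
  have hsum : ∑ s : (X × Y) × X₂, ∑ u : X₁, targetDist P₀ Q (s.1.1, s.1.2, u, s.2) = 1 := by
    rw [← sum_targetDist P₀ Q, ← sum_secondLink]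
    simp only [Fintype.sum_prod_type, Fintype.sum_unique, secondLink]
  rw [informationRegion, Set.mem_ofPred_eq, ← condMutualInfo_unit hsum]
  rfl

theorem mem_informationRegion_of_forall {R : ℝ × ℝ}
    (h : ∀ γ > 0, ∃ R' : ℝ × ℝ, R'.1 ≤ R.1 + γ ∧ R'.2 ≤ R.2 + γ ∧ ∀ᶠ n in atTop,
      ∃ K : CascadeCode X Y X₁ X₂ n (numMessages n R'.1) (numMessages n R'.2),
        K.errorProb P₀ (targetDist P₀ Q) γ ≤ 1 / 2) : R ∈ informationRegion P₀ Q := by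
  have h0 := targetDist_nonneg P₀ Q
  rw [mem_informationRegion_iff, condMutualInfo_firstLink, condMutualInfo_secondLink]
  constructor
  · refine sum_mul_logb_le_of_forall_add_le h0 (fun _ => secondRatio_pos h0) fun η hη =>
      sum_mul_logb_le_of_forall_typical
        (fun s => add_pos_of_nonneg_of_pos (secondRatio_nonneg h0 s) hη) (by positivity)
        fun γ hγ => ?_
    obtain ⟨R', -, hR', hcodes⟩ := h γ hγ
    refine ⟨R'.2, hR', ?_⟩
    filter_upwards [hcodes] with n ⟨K, hK⟩ β hβ0 hβ
    exact half_le_mul_of_secondRatio (le_of_lt hη) hK hβ0 hβ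
  · refine sum_mul_logb_le_of_forall_add_le h0 (fun _ => firstRatio_pos h0) fun η hη =>
      sum_mul_logb_le_of_forall_typical
        (fun s => add_pos_of_nonneg_of_pos (firstRatio_nonneg h0 s) hη) (by positivity)
        fun γ hγ => ?_
    obtain ⟨R', hR', -, hcodes⟩ := h γ hγ
    refine ⟨R'.1, hR', ?_⟩
    filter_upwards [hcodes] with n ⟨K, hK⟩ β hβ0 hβ
    exact half_le_mul_of_firstRatio (le_of_lt hη) hK hβ0 hβ

end Converse

section Regions

variable {X Y X₁ X₂ : Type*} [Fintype X] [Fintype Y] [Fintype X₁] [Fintype X₂]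
  {P₀ : stdSimplex ℝ (X × Y)} {Q : X × Y → stdSimplex ℝ (X₁ × X₂)} {R : ℝ × ℝ}

theorem AchievableCR.eventually_exists_code (h : AchievableCR P₀ Q R) {ε : ℝ} (hε : 0 < ε) :
    ∀ᶠ n in atTop, ∃ K : CascadeCode X Y X₁ X₂ n (numMessages n R.1) (numMessages n R.2),
      K.errorProb P₀ (targetDist P₀ Q) ε ≤ 1 / 2 := by
  obtain ⟨N, p, K, hK⟩ := h
  filter_upwards [(hK ε hε).eventually (ge_mem_nhds one_half_pos)] with n hn
  obtain ⟨ω, hω⟩ := exists_le_of_sum_mul_le (p n).2.1 (p n).2.2 hn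
  exact ⟨K n ω, hω⟩

theorem Achievable.achievableCR (h : Achievable P₀ Q R) : AchievableCR P₀ Q R := by
  obtain ⟨K, hK⟩ := h
  refine ⟨fun _ => 1, fun _ => ⟨fun _ => 1, fun _ => zero_le_one, by simp⟩, fun n _ => K n,
    fun ε hε => (hK ε hε).congr fun n => ?_⟩
  rw [Fin.sum_univ_one]
  exact (one_mul _).symm

theorem continuous_tvDist_targetDist (P₀ : stdSimplex ℝ (X × Y)) (T : X × Y × X₁ × X₂ → ℝ) :
    Continuous fun Q : X × Y → stdSimplex ℝ (X₁ × X₂) => tvDist (targetDist P₀ Q) T := by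
  have hQ (a : X × Y) (b : X₁ × X₂) :
      Continuous fun Q : X × Y → stdSimplex ℝ (X₁ × X₂) => Q a b :=
    (continuous_apply b).comp (continuous_subtype_val.comp (continuous_apply a))
  unfold tvDist targetDist
  exact continuous_const.mul (continuous_finsetSum _ fun s _ =>
    ((continuous_const.mul (hQ _ _)).sub continuous_const).abs)

variable (P₀ Q)

-- Only one code of error at most `1/2` is needed per blocklength, so a nearby target will do.
theorem rateCoordinationRegion_subset :
    rateCoordinationRegion P₀ Q ⊆ informationRegion P₀ Q := by
  intro R hR
  refine mem_informationRegion_of_forall fun γ hγ => ?_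
  have hnear : ∀ᶠ t : (ℝ × ℝ) × (X × Y → stdSimplex ℝ (X₁ × X₂)) in 𝓝 (R, Q),
      t.1.1 < R.1 + γ ∧ t.1.2 < R.2 + γ ∧
        tvDist (targetDist P₀ t.2) (targetDist P₀ Q) < γ / 2 := by
    have htv : Continuous fun t : (ℝ × ℝ) × (X × Y → stdSimplex ℝ (X₁ × X₂)) =>
        tvDist (targetDist P₀ t.2) (targetDist P₀ Q) :=
      (continuous_tvDist_targetDist P₀ _).comp continuous_snd
    have hfst : Continuous fun t : (ℝ × ℝ) × (X × Y → stdSimplex ℝ (X₁ × X₂)) => t.1.1 := by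
      fun_prop
    have hsnd : Continuous fun t : (ℝ × ℝ) × (X × Y → stdSimplex ℝ (X₁ × X₂)) => t.1.2 := by
      fun_prop
    refine (hfst.continuousAt.eventually_lt_const (lt_add_of_pos_right _ hγ)).and
      ((hsnd.continuousAt.eventually_lt_const (lt_add_of_pos_right _ hγ)).and
        (htv.continuousAt.eventually_lt_const ?_))
    simpa only [tvDist_self] using half_pos hγ
  obtain ⟨t, ⟨ht₁, ht₂, httv⟩, ht⟩ := mem_closure_iff_nhds.1 hR _ hnear
  refine ⟨t.1, ht₁.le, ht₂.le, ?_⟩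
  filter_upwards [AchievableCR.eventually_exists_code ht (half_pos hγ)] with n ⟨K, hK⟩
  exact ⟨K, (CascadeCode.errorProb_anti K P₀ (by linarith)).trans hK⟩

theorem achievableRegion_subset : achievableRegion P₀ Q ⊆ rateCoordinationRegion P₀ Q :=
  fun _ hR => map_mem_closure (f := fun R : ℝ × ℝ => (R, Q)) (by fun_prop) hR
    fun _ hR' => Achievable.achievableCR hR'

theorem informationRegion_subset : informationRegion P₀ Q ⊆ achievableRegion P₀ Q := by
  intro R hR
  obtain ⟨hR₂, hR₁⟩ := mem_informationRegion_iff.1 hR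
  have hlim : Tendsto (fun k : ℕ => (R.1 + 1 / ((k : ℝ) + 1), R.2 + 1 / ((k : ℝ) + 1))) atTop
      (𝓝 R) := by
    have h := tendsto_one_div_add_atTop_nhds_zero_nat (𝕜 := ℝ)
    simpa using (h.const_add R.1).prodMk_nhds (h.const_add R.2)
  refine mem_closure_of_tendsto hlim (Eventually.of_forall fun k => ?_)
  have hk : (0 : ℝ) < 1 / ((k : ℝ) + 1) := by positivity
  exact achievable_of_lt (hR₁.trans_lt (lt_add_of_pos_right _ hk))
    (hR₂.trans_lt (lt_add_of_pos_right _ hk))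

end Regions

theorem mainTheorem8 {X Y X₁ X₂ : Type*} [Fintype X] [Fintype Y] [Fintype X₁] [Fintype X₂]
    (P₀ : stdSimplex ℝ (X × Y)) (Q : X × Y → stdSimplex ℝ (X₁ × X₂)) :
    rateCoordinationRegion P₀ Q = informationRegion P₀ Q ∧
      achievableRegion P₀ Q = informationRegion P₀ Q :=
  ⟨(rateCoordinationRegion_subset P₀ Q).antisymm
      ((informationRegion_subset P₀ Q).trans (achievableRegion_subset P₀ Q)),
    ((achievableRegion_subset P₀ Q).trans (rateCoordinationRegion_subset P₀ Q)).antisymm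
      (informationRegion_subset P₀ Q)⟩
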